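/- Let $\mathbb{k}$ be a field, let $N\ge 3$, and let $A_N$ be the affine nilTemperley-Lieb algebra of rank $N$: the unital associative $\mathbb{k}$-algebra generated by $a_i$ ($i\in\mathbb{Z}/N\mathbb{Z}$) with the relations $a_i^2=0$ for all $i$, $a_ia_j=a_ja_i$ whenever $i-j\ne\pm1$ in $\mathbb{Z}/N\mathbb{Z}$, and $a_ia_{i+1}a_i=a_{i+1}a_ia_{i+1}=0$ for all $i$. Indices of generators are always read modulo $N$. For $1\le k\le N-1$ and $I=\{i_1<\dots<i_k\}\subseteq\{1,\dots,N\}$, put $i_{k+1}:=i_1+N$, choose an index $1\le\ell\le k$ with $i_\ell+1<i_{\ell+1}$ (such a gap exists because $k<N$), and set $$a(\hat I)=(a_{i_1-1}a_{i_1-2}\cdots a_{i_k+1})\cdot\prod_{s=1}^{k-1}(a_{i_{s+1}-1}a_{i_{s+1}-2}\cdots a_{i_s+1})\cdot(a_{i_{\ell+1}}\cdots a_{i_k})\cdot(a_{i_1}\cdots a_{i_\ell}),$$ where in the first factor the indices run downwards from $i_1+N-1$ to $i_k+1$, and empty products are $1$. Put $$t_k=(-1)^{k-1}\sum_{|I|=k}a(\hat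 I)\qquad(1\le k\le N-1).$$ Then, for every choice of the gaps: 1. Each $t_k$, $1\le k\le N-1$, is central in $A_N$, and the center of $A_N$ is the subalgebra generated by $1,t_1,\dots,t_{N-1}$. 2. For each $1\le k\le N-1$ the subalgebra of $A_N$ generated by $t_k$ is a polynomial ring in $t_k$, that is, there is a $\mathbb{k}$-algebra isomorphism from $\mathbb{k}[q]$ onto it that sends $q$ to $t_k$. Moreover $t_kt_\ell=0$ for all $k\ne\ell$. The center of $A_N$ is the internal direct sum $$\mathbb{k}\oplus t_1\mathbb{k}[t_1]\oplus\dots\oplus t_{N-1}\mathbb{k}[t_{N-1}],$$ and there is a $\mathbb{k}$-algebra isomorphism $$\mathbb{k}[T_1,\dots,T_{N-1}]/(T_kT_\ell\mid k\ne\ell)\;\cong\;\text{the center of }A_N$$ that sends the class of $T_k$ to $t_k$ for every $k$. -/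

import Mathlib

open scoped Polynomial

namespace AffineNilTL

/-- The defining relations of the affine nilTemperley-Lieb algebra of rank `N` (for `3 ≤ N`),
on the free algebra with generators `a i`, `i ∈ ℤ/Nℤ`. -/
inductive Rel (K : Type*) [Field K] (N : ℕ) :
    FreeAlgebra K (ZMod N) → FreeAlgebra K (ZMod N) → Prop
  | sq (i : ZMod N) : Rel K N (FreeAlgebra.ι K i * FreeAlgebra.ι K i) 0
  | comm (i j : ZMod N) (h₁ : i - j ≠ 1) (h₂ : i - j ≠ -1) :
      Rel K N (FreeAlgebra.ι K i * FreeAlgebra.ι K j) (FreeAlgebra.ι K j * FreeAlgebra.ι K i)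
  | braid (i : ZMod N) :
      Rel K N (FreeAlgebra.ι K i * FreeAlgebra.ι K (i + 1) * FreeAlgebra.ι K i) 0
  | braid' (i : ZMod N) :
      Rel K N (FreeAlgebra.ι K (i + 1) * FreeAlgebra.ι K i * FreeAlgebra.ι K (i + 1)) 0

end AffineNilTL

/-- The affine nilTemperley-Lieb algebra of rank `N` over `K`. -/
abbrev AffineNilTL (K : Type*) [Field K] (N : ℕ) : Type _ := RingQuot (AffineNilTL.Rel K N)

namespace AffineNilTL

section

variable (K : Type*) [Field K] (N : ℕ)

/-- The generator `a_i`, `i ∈ ℤ/Nℤ`. -/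
noncomputable def gen (i : ZMod N) : AffineNilTL K N :=
  RingQuot.mkAlgHom K (Rel K N) (FreeAlgebra.ι K i)

/-- The monomial `a_{j₁} a_{j₂} ⋯ a_{jₘ}` of a list of indices, which are read modulo `N`. -/
noncomputable def monomial (js : List ℕ) : AffineNilTL K N :=
  (js.map fun j => gen K N (j : ZMod N)).prod

/-- The monomial `a_{r-1} a_{r-2} ⋯ a_{p+2} a_{p+1}` with decreasing indices strictly between
`p` and `r` (it is `1` if there are none). -/
noncomputable def descMonomial (p r : ℕ) : AffineNilTL K N :=
  monomial K N (List.range' (p + 1) (r - (p + 1))).reverse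

end

/-- `entry I s` is the entry `i_s` (`1 ≤ s ≤ k`) of the increasing sequence `i_1 < ⋯ < i_k` of
the elements of `I`. -/
def entry (I : Finset ℕ) (s : ℕ) : ℕ := (I.sort (· ≤ ·)).getD (s - 1) 0

/-- For `I = {i_1 < ⋯ < i_k} ⊆ {1, …, N}`, the index `1 ≤ ℓ ≤ k` is a gap if the position that
follows `i_ℓ` on the circle with `N` positions is not in `I`: `i_ℓ + 1 < i_{ℓ+1}` if `ℓ < k`, and
`i_k + 1 < i_1 + N` if `ℓ = k`. -/
def IsGap (N : ℕ) (I : Finset ℕ) (l : ℕ) : Prop :=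
  1 ≤ l ∧
    ((l < I.card ∧ entry I l + 1 < entry I (l + 1)) ∨
      (l = I.card ∧ entry I I.card + 1 < entry I 1 + N))

section

variable (K : Type*) [Field K] (N : ℕ)

/-- The monomial `a(Î)` attached to `I = {i_1 < ⋯ < i_k} ⊆ {1, …, N}`, `1 ≤ k ≤ N - 1`, written
down with the help of a gap `l`:
`(a_{i_1-1} a_{i_1-2} ⋯ a_{i_k+1}) · ∏_{s=1}^{k-1} (a_{i_{s+1}-1} a_{i_{s+1}-2} ⋯ a_{i_s+1})
  · (a_{i_{l+1}} ⋯ a_{i_k}) · (a_{i_1} ⋯ a_{i_l})`.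
In the first factor the indices run modulo `N` from `i_1 - 1 ≡ i_1 + N - 1` down to `i_k + 1`. -/
noncomputable def hatMonomial (I : Finset ℕ) (l : ℕ) : AffineNilTL K N :=
  descMonomial K N (entry I I.card) (entry I 1 + N) *
    ((List.range' 1 (I.card - 1)).map fun s =>
      descMonomial K N (entry I s) (entry I (s + 1))).prod *
    monomial K N ((List.range' (l + 1) (I.card - l)).map (entry I)) *
    monomial K N ((List.range' 1 l).map (entry I))

/-- `t_k = (-1)^(k-1) ∑_{|I| = k} a(Î)`, the sum over all `I ⊆ {1, …, N}` with `k` elements;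
`gap I` is the gap of `I` with which `a(Î)` is written down. -/
noncomputable def t (gap : Finset ℕ → ℕ) (k : ℕ) : AffineNilTL K N :=
  (-1) ^ (k - 1) * ∑ I ∈ (Finset.Icc 1 N).powersetCard k, hatMonomial K N I (gap I)

/-- The summands `K·1` (for `k = 0`) and `t_k K[t_k]` (for `k = 1, …, N - 1`). -/
noncomputable def summand (gap : Finset ℕ → ℕ) (k : Fin N) :
    Submodule K (AffineNilTL K N) :=
  if (k : ℕ) = 0 then Submodule.span K {1}
  else (Subalgebra.toSubmodule (Algebra.adjoin K {t K N gap k})).map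
    (LinearMap.mulLeft K (t K N gap k))

end

end AffineNilTL

namespace AffineNilTL
theorem entry_lt (I : Finset ℕ) {s r : ℕ} (hs : 1 ≤ s) (hsr : s < r) (hr : r ≤ I.card) :
    entry I s < entry I r := by
  have h1 : s - 1 < (I.sort (· ≤ ·)).length := by simp; omega
  have h2 : r - 1 < (I.sort (· ≤ ·)).length := by simp; omega
  unfold entry
  rw [List.getD_eq_getElem _ _ h1, List.getD_eq_getElem _ _ h2]
  exact (Finset.sortedLT_sort I).getElem_lt_getElem_iff.2 (by omega)

/-- Every nonempty proper `I ⊆ {1, …, N}` has a gap. -/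
theorem exists_isGap (N : ℕ) (I : Finset ℕ) (h1 : 1 ≤ I.card) (h2 : I.card ≤ N - 1) :
    ∃ l, IsGap N I l := by
  by_contra! h
  have key : ∀ s, 1 ≤ s → s ≤ I.card → entry I s + 1 = entry I 1 + s := by
    intro s hs
    induction s, hs using Nat.le_induction with
    | base => intro _; rfl
    | succ s hs ih =>
      intro hk
      have a := ih (by omega)
      have b : entry I s < entry I (s + 1) := entry_lt I hs (Nat.lt_succ_self s) hk
      have c : ¬ entry I s + 1 < entry I (s + 1) :=
        fun hlt => h s ⟨hs, Or.inl ⟨by omega, hlt⟩⟩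
      omega
  have a := key I.card h1 le_rfl
  exact h I.card ⟨h1, Or.inr ⟨rfl, by omega⟩⟩

end AffineNilTL

/-! The algebra acts faithfully on particle configurations, the subsets `S` of the circle `ZMod N`,
over `K[X]`: the letter `i` moves a particle from `i + 1` to a vacant `i`, and `X` records each use
of the letter `0`. A word therefore acts by a matrix whose entries are `0` or powers of `X`.

Faithfulness (`rep_injective`) has two halves. A nonzero monomial can be carried out on some
configuration (`exists_admissible`). Source, target and winding number determine a word up to
rearrangement (`Admissible.perm`), and rearrangements admissible for the same configuration give the
same monomial (`word_eq_of_perm`). So each coefficient of an element can be read off from one matrix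
entry.

The word `a(Î)` uses every letter once, in an order that carries each particle to the place of the
next one. It acts as `X` times the elementary matrix at the configuration `I`, whichever gap is used
(`rep_hatMonomial`), so `t_k` acts as `±X` on configurations of `k` particles and as `0` on all
others.

Commuting with every `a(Î)` forces a central element to be diagonal; commuting with the generators
makes its entries depend only on the number of particles. The constant terms all agree, and on the
empty and the full circle nothing else survives. The center thus consists of a scalar plus
independent polynomials in `X K[X]`, one for each `1 ≤ k ≤ N - 1`, which are supplied by `t_k
K[t_k]`. -/

namespace AffineNilTL

/-! ### Particle configurations on a circle -/

section Configurations

variable {N : ℕ}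

/-- Move a particle from position `i + 1` to position `i`. -/
def move (i : ZMod N) (S : Finset (ZMod N)) : Finset (ZMod N) := insert i (S.erase (i + 1))

theorem mem_move {i p : ZMod N} {S : Finset (ZMod N)} :
    p ∈ move i S ↔ p = i ∨ (p ≠ i + 1 ∧ p ∈ S) := by
  simp [move]

/-- The letters of the word `w`, read from left to right, can successively be used to move the
particles of the configuration `S`: the letter `i` takes a particle from `i + 1` to the vacant
position `i`. -/
def Admissible : List (ZMod N) → Finset (ZMod N) → Prop
  | [], _ => True
  | i :: w, S => (i + 1 ∈ S ∧ i ∉ S) ∧ Admissible w (move i S)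

/-- The configuration reached from `S` along the word `w`. -/
def target : List (ZMod N) → Finset (ZMod N) → Finset (ZMod N)
  | [], S => S
  | i :: w, S => target w (move i S)

@[simp] theorem admissible_nil (S : Finset (ZMod N)) : Admissible [] S := trivial

@[simp] theorem admissible_cons {i : ZMod N} {w : List (ZMod N)} {S : Finset (ZMod N)} :
    Admissible (i :: w) S ↔ (i + 1 ∈ S ∧ i ∉ S) ∧ Admissible w (move i S) := Iff.rfl

@[simp] theorem target_nil (S : Finset (ZMod N)) : target [] S = S := rfl

@[simp] theorem target_cons {i : ZMod N} {w : List (ZMod N)} {S : Finset (ZMod N)} :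
    target (i :: w) S = target w (move i S) := rfl

theorem admissible_append {u v : List (ZMod N)} {S : Finset (ZMod N)} :
    Admissible (u ++ v) S ↔ Admissible u S ∧ Admissible v (target u S) := by
  induction u generalizing S with
  | nil => simp
  | cons i u ih => simp [ih, and_assoc]

theorem card_move {i : ZMod N} {S : Finset (ZMod N)} (h : i + 1 ∈ S) (h' : i ∉ S) :
    (move i S).card = S.card := by
  have h1 : i ∉ S.erase (i + 1) := fun h => h' (Finset.mem_of_mem_erase h)
  rw [move, Finset.card_insert_of_notMem h1, Finset.card_erase_add_one h]

theorem Admissible.card_target {w : List (ZMod N)} {S : Finset (ZMod N)} (h : Admissible w S) :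
    (target w S).card = S.card := by
  induction w generalizing S with
  | nil => rfl
  | cons i w ih => rw [target_cons, ih h.2, card_move h.1.1 h.1.2]

/-- The letter `i` inspects and changes only the positions `i` and `i + 1`, so the occupation of
untouched positions is irrelevant. -/
theorem admissible_congr {w : List (ZMod N)} {S T : Finset (ZMod N)}
    (h : ∀ p, p ∈ w ∨ p - 1 ∈ w → (p ∈ S ↔ p ∈ T)) (hS : Admissible w S) : Admissible w T := by
  induction w generalizing S T with
  | nil => trivial
  | cons i w ih =>
    refine ⟨⟨(h _ (by simp)).1 hS.1.1, fun h' => hS.1.2 ((h _ (by simp)).2 h')⟩, ih ?_ hS.2⟩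
    intro p hp
    have := h p (hp.imp (List.mem_cons_of_mem _) (List.mem_cons_of_mem _))
    simp [mem_move, this]

/-- The first letter touching `p` dictates whether `p` must be occupied at the start. -/
theorem Admissible.eq_of_mem {w : List (ZMod N)} {S T : Finset (ZMod N)} (hS : Admissible w S)
    (hT : Admissible w T) {p : ZMod N} (hp : p ∈ w ∨ p - 1 ∈ w) : p ∈ S ↔ p ∈ T := by
  induction w generalizing S T with
  | nil => simp at hp
  | cons i w ih =>
    by_cases h1 : p = i
    · subst h1; simp [hS.1.2, hT.1.2]
    by_cases h2 : p = i + 1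
    · subst h2; simp [hS.1.1, hT.1.1]
    have h3 : p - 1 ≠ i := fun h => h2 (by rw [← h]; ring)
    have := ih hS.2 hT.2 (by simpa [h1, h3] using hp)
    simpa [mem_move, h1, h2] using this

theorem move_comm {i j : ZMod N} (h₁ : i ≠ j + 1) (h₂ : j ≠ i + 1) (S : Finset (ZMod N)) :
    move i (move j S) = move j (move i S) := by
  ext p
  simp only [mem_move]
  grind

variable [Fact (3 ≤ N)]

theorem one_ne_zero_zmod : (1 : ZMod N) ≠ 0 := by
  have h3 : 3 ≤ N := Fact.out
  intro h
  have := (ZMod.natCast_eq_zero_iff 1 N).1 (by simpa using h)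
  exact absurd (Nat.le_of_dvd (by norm_num) this) (by omega)

theorem two_ne_zero_zmod : (1 + 1 : ZMod N) ≠ 0 := by
  have h3 : 3 ≤ N := Fact.out
  intro h
  have := (ZMod.natCast_eq_zero_iff 2 N).1 (by push_cast; rw [← h]; norm_num)
  exact absurd (Nat.le_of_dvd (by norm_num) this) (by omega)

theorem ne_add_one (i : ZMod N) : i ≠ i + 1 := fun h => one_ne_zero_zmod (left_eq_add.1 h)

open Classical in
/-- The occupation of a position changes according to the letters that fill and empty it. -/
theorem Admissible.count_add {w : List (ZMod N)} {S : Finset (ZMod N)} (h : Admissible w S)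
    (p : ZMod N) :
    w.count p + (if p ∈ S then 1 else 0) =
      w.count (p - 1) + (if p ∈ target w S then 1 else 0) := by
  induction w generalizing S with
  | nil => by_cases hp : p ∈ S <;> simp [hp]
  | cons i w ih =>
    have key := ih h.2
    obtain ⟨⟨h1, h2⟩, -⟩ := h
    rw [target_cons, List.count_cons, List.count_cons]
    by_cases hp : p = i
    · subst hp
      have h4 : p ≠ p - 1 := fun h => ne_add_one p (by rw [← sub_eq_iff_eq_add, ← h])
      simp [mem_move, h4, h2] at key ⊢
      omega
    · by_cases hp' : p = i + 1
      · subst hp'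
        simp [mem_move, h1, hp, ne_add_one i] at key ⊢
        omega
      · have h3 : i ≠ p - 1 := fun h => hp' (by rw [h]; ring)
        simp [mem_move, hp, hp', h3, Ne.symm hp] at key ⊢
        exact key

/-- Position `p` is filled by the letter `p` and emptied by `p - 1`, so the two counts differ by at
most one, in a direction fixed by the initial occupation. The next three lemmas are of the same
kind. -/
theorem Admissible.notMem_pred {w : List (ZMod N)} {S : Finset (ZMod N)} (h : Admissible w S)
    {p : ZMod N} (hp : p ∉ S) (hw : p ∉ w) : p - 1 ∉ w := by
  have := h.count_add p
  rw [List.count_eq_zero_of_not_mem hw, if_neg hp] at this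
  exact List.count_eq_zero.1 (by omega)

theorem Admissible.notMem_of_pred {w : List (ZMod N)} {S : Finset (ZMod N)} (h : Admissible w S)
    {p : ZMod N} (hp : p ∈ S) (hw : p - 1 ∉ w) : p ∉ w := by
  classical
  have := h.count_add p
  rw [List.count_eq_zero_of_not_mem hw, if_pos hp] at this
  refine List.count_eq_zero.1 ?_
  split_ifs at this <;> omega

theorem Admissible.count_le_one {w : List (ZMod N)} {S : Finset (ZMod N)} (h : Admissible w S)
    {p : ZMod N} (hw : p - 1 ∉ w) : w.count p ≤ 1 := by
  classical
  have := h.count_add p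
  rw [List.count_eq_zero_of_not_mem hw] at this
  split_ifs at this <;> omega

theorem Admissible.count_pred_le_one {w : List (ZMod N)} {S : Finset (ZMod N)}
    (h : Admissible w S) {p : ZMod N} (hw : p ∉ w) : w.count (p - 1) ≤ 1 := by
  classical
  have := h.count_add p
  rw [List.count_eq_zero_of_not_mem hw] at this
  split_ifs at this <;> omega

theorem forall_of_zero_of_add_one {P : ZMod N → Prop} (h0 : P 0) (h : ∀ p, P (p - 1) → P p)
    (p : ZMod N) : P p := by
  have : NeZero N := ⟨by have : 3 ≤ N := Fact.out; omega⟩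
  obtain ⟨n, rfl⟩ := ZMod.natCast_zmod_surjective p
  induction n with
  | zero => simpa using h0
  | succ n ih => exact h _ (by simpa using ih)

/-- Admissible words with the same source, the same target, and the same winding number are
rearrangements of each other. -/
theorem Admissible.perm {w v : List (ZMod N)} {S : Finset (ZMod N)} (hw : Admissible w S)
    (hv : Admissible v S) (ht : target w S = target v S) (h0 : w.count 0 = v.count 0) :
    w.Perm v := by
  rw [List.perm_iff_count]
  -- Given source and target, `count_add` yields the count of `p` from that of `p - 1`; the count of
  -- `0` fixes the rest around the circle.
  refine forall_of_zero_of_add_one h0 fun p hp => ?_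
  have h1 := hw.count_add p
  have h2 := hv.count_add p
  rw [ht] at h1
  omega

end Configurations

/-! ### Relations between monomials -/

section Words

variable (K : Type*) [Field K] {N : ℕ}

/-- The product `a_{i₁} ⋯ a_{iₘ}` of the generators along a word. -/
noncomputable def word (w : List (ZMod N)) : AffineNilTL K N := (w.map (gen K N)).prod

@[simp] theorem word_nil : word K ([] : List (ZMod N)) = 1 := rfl

@[simp] theorem word_cons (i : ZMod N) (w : List (ZMod N)) :
    word K (i :: w) = gen K N i * word K w := by simp [word]

@[simp] theorem word_append (u v : List (ZMod N)) : word K (u ++ v) = word K u * word K v := by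
  simp [word]

theorem gen_mul_self (i : ZMod N) : gen K N i * gen K N i = 0 := by
  simpa [gen] using RingQuot.mkAlgHom_rel K (Rel.sq (K := K) i)

theorem gen_comm {i j : ZMod N} (h₁ : i ≠ j + 1) (h₂ : j ≠ i + 1) :
    Commute (gen K N i) (gen K N j) := by
  have := RingQuot.mkAlgHom_rel K (Rel.comm (K := K) i j (fun h => h₁ (by rw [← h]; ring))
    (fun h => h₂ (by rw [← neg_sub, neg_inj] at h; rw [← h]; ring)))
  simpa [gen, Commute, SemiconjBy] using this

theorem gen_braid (i : ZMod N) : gen K N i * gen K N (i + 1) * gen K N i = 0 := by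
  simpa [gen] using RingQuot.mkAlgHom_rel K (Rel.braid (K := K) i)

theorem gen_braid' (i : ZMod N) : gen K N (i + 1) * gen K N i * gen K N (i + 1) = 0 := by
  simpa [gen] using RingQuot.mkAlgHom_rel K (Rel.braid' (K := K) i)

theorem gen_comm_word {i : ZMod N} {w : List (ZMod N)} (h₁ : i + 1 ∉ w) (h₂ : i - 1 ∉ w) :
    Commute (gen K N i) (word K w) := by
  refine Commute.list_prod_right _ _ fun x hx => ?_
  obtain ⟨j, hj, rfl⟩ := List.mem_map.1 hx
  exact gen_comm K (fun h => h₂ (by rwa [h, add_sub_cancel_right])) (fun h => h₁ (h ▸ hj))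

/-- If `j` is the only letter that can obstruct commuting with `i` and occurs at most once,
everything else slides out, leaving `a_i a_j a_i` or `a_i²`. -/
theorem gen_mul_word_mul_gen_eq_zero {i j : ZMod N} {u : List (ZMod N)}
    (hj : gen K N i * gen K N j * gen K N i = 0)
    (hcomm : ∀ v : List (ZMod N), j ∉ v → (∀ x ∈ v, x ∈ u) → Commute (gen K N i) (word K v))
    (hu : u.count j ≤ 1) : gen K N i * word K u * gen K N i = 0 := by
  by_cases h : j ∈ u
  · obtain ⟨v, v', rfl, hv⟩ := List.eq_append_cons_of_mem h
    have hv' : j ∉ v' := by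
      simp only [List.count_append, List.count_cons_self] at hu
      exact List.count_eq_zero.1 (by omega)
    have h1 := hcomm v hv (by simp +contextual)
    have h2 := hcomm v' hv' (by simp +contextual)
    rw [word_append, word_cons]
    calc _ = (gen K N i * word K v) * (gen K N j * (word K v' * gen K N i)) := by noncomm_ring
      _ = word K v * (gen K N i * gen K N j * gen K N i) * word K v' := by
        rw [h1.eq, ← h2.eq]; noncomm_ring
      _ = 0 := by rw [hj]; simp
  · rw [(hcomm u h (fun _ => id)).eq, mul_assoc, gen_mul_self, mul_zero]

theorem span_range_word : Submodule.span K (Set.range (word K (N := N))) = ⊤ := by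
  rw [eq_top_iff]
  rintro x -
  obtain ⟨y, rfl⟩ := RingQuot.mkAlgHom_surjective K (Rel K N) x
  have hmul : ∀ a ∈ Submodule.span K (Set.range (word K (N := N))),
      ∀ b ∈ Submodule.span K (Set.range (word K (N := N))),
      a * b ∈ Submodule.span K (Set.range (word K (N := N))) := by
    intro a ha b hb
    have := Submodule.mul_mem_mul ha hb
    rw [Submodule.span_mul_span] at this
    refine Submodule.span_mono ?_ this
    rintro _ ⟨_, ⟨u, rfl⟩, _, ⟨v, rfl⟩, rfl⟩
    exact ⟨u ++ v, by simp⟩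
  induction y using FreeAlgebra.induction with
  | grade0 r =>
    rw [AlgHom.commutes, Algebra.algebraMap_eq_smul_one]
    exact Submodule.smul_mem _ _ (Submodule.subset_span ⟨[], rfl⟩)
  | grade1 i => exact Submodule.subset_span ⟨[i], by simp [gen]⟩
  | mul a b ha hb => rw [map_mul]; exact hmul _ ha _ hb
  | add a b ha hb => rw [map_add]; exact Submodule.add_mem _ ha hb

variable [Fact (3 ≤ N)]

/-- A monomial is zero unless it has an admissible configuration. -/
theorem exists_admissible {w : List (ZMod N)} (hw : word K w ≠ 0) : ∃ S, Admissible w S := by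
  induction w with
  | nil => exact ⟨∅, trivial⟩
  | cons i v ih =>
    rw [word_cons] at hw
    obtain ⟨S, hS⟩ := ih (fun h => hw (by rw [h, mul_zero]))
    have hsplit : ∀ u u', v = u ++ i :: u' → gen K N i * word K u * gen K N i ≠ 0 := by
      rintro u u' rfl h
      apply hw
      rw [word_append, word_cons, ← mul_assoc, ← mul_assoc, h, zero_mul]
    -- For `i` to be put in front, `v` must accept a configuration with `i` filled and `i + 1`
    -- vacant. If `S` is wrong at one of these positions and `v` touches it, the stretch of `v`
    -- before its first `i` misses one neighbour of `i` and contains the other at most once, so the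
    -- monomial vanishes.
    have h1 : i ∈ S ∨ (i ∉ v ∧ i - 1 ∉ v) := by
      by_contra! h
      by_cases hi : i ∈ v
      · obtain ⟨u, u', rfl, hu⟩ := List.eq_append_cons_of_mem hi
        have hS' := (admissible_append.1 hS).1
        have hu1 := hS'.notMem_pred h.1 hu
        refine hsplit u u' rfl (gen_mul_word_mul_gen_eq_zero K (gen_braid K i) ?_
          (hS'.count_le_one (p := i + 1) (by simpa using hu)))
        exact fun v hv hvu => gen_comm_word K hv (fun h => hu1 (hvu _ h))
      · exact hS.notMem_pred h.1 hi (h.2 hi)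
    have h2 : i + 1 ∉ S ∨ (i + 1 ∉ v ∧ i ∉ v) := by
      by_contra! h
      by_cases hi : i ∈ v
      · obtain ⟨u, u', rfl, hu⟩ := List.eq_append_cons_of_mem hi
        have hS' := (admissible_append.1 hS).1
        have hu1 := hS'.notMem_of_pred h.1 (by simpa using hu)
        have hb := gen_braid' K (i - 1)
        rw [sub_add_cancel] at hb
        refine hsplit u u' rfl (gen_mul_word_mul_gen_eq_zero K hb ?_
          (hS'.count_pred_le_one hu))
        exact fun v hv hvu => gen_comm_word K (fun h => hu1 (hvu _ h)) hv
      · exact hi (h.2 (hS.notMem_of_pred h.1 (by simpa using hi)))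
    -- After the move `i` this configuration differs from `S` at most at `i` and `i + 1`, and only
    -- where `v` does not look.
    refine ⟨insert (i + 1) (S.erase i), ⟨by simp [ne_add_one i], ?_⟩⟩
    refine admissible_congr (fun p hp => ?_) hS
    by_cases hp1 : p = i
    · subst hp1
      simp only [mem_move, true_or, iff_true]
      tauto
    · by_cases hp2 : p = i + 1
      · subst hp2
        simp only [mem_move, (ne_add_one i).symm, add_sub_cancel_right] at hp ⊢
        tauto
      · simp [mem_move, hp1, hp2]

end Words

/-! ### The representation on particle configurations -/

section Representation

variable (K : Type*) [Field K] {N : ℕ}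

/-- The variable `X` counts the particles that pass from `1` to `0`. -/
noncomputable def weight (i : ZMod N) : K[X] := if i = 0 then Polynomial.X else 1

theorem prod_weight (w : List (ZMod N)) :
    (w.map (weight K)).prod = Polynomial.X ^ w.count 0 := by
  induction w with
  | nil => simp
  | cons i w ih =>
    rw [List.map_cons, List.prod_cons, ih, weight, List.count_cons]
    by_cases h : i = 0 <;> simp [h, pow_succ']

open Classical in
/-- The matrix by which a generator acts. -/
noncomputable def genMatrix (i : ZMod N) :
    Matrix (Finset (ZMod N)) (Finset (ZMod N)) K[X] := fun S T =>
  if Admissible [i] S ∧ target [i] S = T then weight K i else 0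

variable [NeZero N]

open Classical in
theorem prod_genMatrix (w : List (ZMod N)) (S T : Finset (ZMod N)) :
    (w.map (genMatrix K)).prod S T =
      if Admissible w S ∧ target w S = T then (w.map (weight K)).prod else 0 := by
  induction w generalizing S with
  | nil => simp [Matrix.one_apply]
  | cons i w ih =>
    rw [List.map_cons, List.prod_cons, Matrix.mul_apply]
    rw [Finset.sum_eq_single (move i S)]
    · rw [ih, genMatrix]
      by_cases h1 : i + 1 ∈ S ∧ i ∉ S
      · simp [h1]
      · simp [h1]
    · intro U _ hU
      rw [genMatrix, if_neg (fun h => hU h.2.symm), zero_mul]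
    · simp

open Classical in
theorem prod_genMatrix_eq_zero {w : List (ZMod N)} (h : ∀ S, ¬ Admissible w S) :
    (w.map (genMatrix K)).prod = 0 := by
  ext1 S T
  rw [prod_genMatrix, if_neg (fun h' => h S h'.1), Matrix.zero_apply]

variable [Fact (3 ≤ N)]

/-- The vanishing relations hold because their words are admissible nowhere. This needs `i + 2 ≠ i`:
on a circle of two positions a particle could keep circulating. -/
theorem genMatrix_rel {x y : FreeAlgebra K (ZMod N)} (h : Rel K N x y) :
    FreeAlgebra.lift K (genMatrix K) x = FreeAlgebra.lift K (genMatrix K) y := by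
  have h1 := one_ne_zero_zmod (N := N)
  have h2 := two_ne_zero_zmod (N := N)
  cases h with
  | sq i =>
    have := prod_genMatrix_eq_zero K (w := [i, i]) (by simp +contextual [mem_move])
    simpa using this
  | comm i j h₁ h₂ =>
    have h₃ : i ≠ j + 1 := fun h => h₁ (by rw [h]; ring)
    have h₄ : j ≠ i + 1 := fun h => h₂ (by rw [h]; ring)
    have : (List.map (genMatrix K) [i, j]).prod = (List.map (genMatrix K) [j, i]).prod := by
      ext1 S T
      rw [prod_genMatrix, prod_genMatrix]
      by_cases hij : i = j
      · rw [hij]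
      congr 1
      · simp only [admissible_cons, admissible_nil, target_cons, target_nil, move_comm h₃ h₄,
          mem_move, and_true]
        grind
      · simp [mul_comm]
    simpa using this
  | braid i =>
    have := prod_genMatrix_eq_zero K (w := [i, i + 1, i])
      (by simp +contextual [mem_move, add_assoc, h2])
    simpa [mul_assoc] using this
  | braid' i =>
    have := prod_genMatrix_eq_zero K (w := [i + 1, i, i + 1])
      (by simp +contextual [mem_move, add_assoc, h2, h1])
    simpa [mul_assoc] using this

/-- The representation of the affine nilTemperley-Lieb algebra on particle configurations. -/
noncomputable def rep :
    AffineNilTL K N →ₐ[K] Matrix (Finset (ZMod N)) (Finset (ZMod N)) K[X] :=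
  RingQuot.liftAlgHom K ⟨FreeAlgebra.lift K (genMatrix K), fun _ _ h => genMatrix_rel K h⟩

theorem rep_gen (i : ZMod N) : rep K (gen K N i) = genMatrix K i := by
  simp [rep, gen]

open Classical in
theorem rep_word (w : List (ZMod N)) (S T : Finset (ZMod N)) :
    rep K (word K w) S T =
      if Admissible w S ∧ target w S = T then Polynomial.X ^ w.count 0 else 0 := by
  rw [word, map_list_prod, List.map_map, ← prod_weight, ← prod_genMatrix,
    show rep K ∘ gen K N = genMatrix K from funext fun i => rep_gen K i]

theorem rep_word_of_admissible {w : List (ZMod N)} {S : Finset (ZMod N)} (h : Admissible w S) :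
    rep K (word K w) S (target w S) = Polynomial.X ^ w.count 0 := by
  classical
  rw [rep_word, if_pos ⟨h, rfl⟩]

/-- Admissibility is visible in the matrix, since powers of `X` are nonzero; it therefore passes
between words with equal monomials without any combinatorics. -/
theorem admissible_of_word_eq {w v : List (ZMod N)} {S : Finset (ZMod N)}
    (h : word K w = word K v) (hw : Admissible w S) : Admissible v S := by
  classical
  have := rep_word_of_admissible K hw
  rw [h, rep_word] at this
  by_contra hv
  rw [if_neg (fun h => hv h.1)] at this
  exact pow_ne_zero _ Polynomial.X_ne_zero this.symm

/-- Rearranged words that are admissible for the same configuration give the same monomial. -/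
theorem word_eq_of_perm {w v : List (ZMod N)} {S : Finset (ZMod N)} (hw : Admissible w S)
    (hv : Admissible v S) (h : w.Perm v) : word K w = word K v := by
  induction w generalizing v S with
  | nil => rw [List.nil_perm.1 h]
  | cons i w ih =>
    -- Before the first `i` in `v`, position `i + 1` stays filled and `i` stays vacant, so `u`
    -- contains no neighbour of `i` and `i` can be pulled to the front.
    obtain ⟨u, u', rfl, hu⟩ := List.eq_append_cons_of_mem (h.subset List.mem_cons_self)
    have hS := (admissible_append.1 hv).1
    have h1 : word K (u ++ i :: u') = word K (i :: (u ++ u')) := by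
      have := gen_comm_word K (hS.notMem_of_pred hw.1.1 (by simpa using hu))
        (hS.notMem_pred hw.1.2 hu)
      rw [word_append, word_cons, word_cons, word_append, ← mul_assoc, ← mul_assoc, this.eq]
    have h2 := admissible_of_word_eq K h1 hv
    rw [h1, word_cons, word_cons, ih hw.2 h2.2]
    exact (List.perm_cons i).1 (h.trans List.perm_middle)

theorem rep_injective : Function.Injective (rep K (N := N)) := by
  classical
  rw [injective_iff_map_eq_zero]
  intro x hx
  have hx' : x ∈ Submodule.span K (Set.range (word K (N := N))) := by
    rw [span_range_word]; trivial
  -- The coefficients are indexed by monomials as elements of the algebra, so different words for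
  -- one monomial are already merged.
  obtain ⟨c, hc, rfl⟩ := (Submodule.mem_span_set (R := K)).1 hx'
  refine Finset.sum_eq_zero fun m hm => ?_
  obtain ⟨w, rfl⟩ := hc hm
  by_cases hw : word K w = 0
  · simp [hw]
  obtain ⟨S, hS⟩ := exists_admissible K hw
  have h1 : (rep K (c.sum fun m r => r • m) S (target w S)).coeff (w.count 0) = 0 := by
    rw [hx]; simp
  have h2 : c (word K w) = 0 := by
    rw [← h1, Finsupp.sum, map_sum, Matrix.sum_apply, Polynomial.finsetSum_coeff,
      Finset.sum_eq_single (word K w)]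
    · rw [map_smul, Matrix.smul_apply, rep_word_of_admissible K hS]; simp
    · intro m hm hmw
      obtain ⟨v, rfl⟩ := hc hm
      rw [map_smul, Matrix.smul_apply, rep_word]
      split_ifs with hv
      · have : w.count 0 ≠ v.count 0 := fun h =>
          hmw (word_eq_of_perm K hS hv.1 (hS.perm hv.1 hv.2.symm h)).symm
        simp [Polynomial.coeff_X_pow, this]
      · simp
    · intro h
      rw [Finsupp.notMem_support_iff.1 h]; simp
  simp only [h2, zero_smul]

end Representation

/-! ### The monomials `a(Î)` -/

section Loops

variable {N : ℕ}

/-- The order in which the letters `x` and `y` may occur in a word that contains each letter once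
and brings the configuration `S` back to itself. -/
def MayPrecede (S : Finset (ZMod N)) (x y : ZMod N) : Prop :=
  x ≠ y ∧ (x = y + 1 → x ∉ S) ∧ (y = x + 1 → y ∈ S)

variable [Fact (3 ≤ N)]

/-- Induction over the suffixes of a loop. `T` is the configuration from which the remaining letters
`v` lead to `S`: a position still to be emptied is filled, one still to be filled is vacant, and all
others are as in `S`. -/
theorem admissible_suffix_of_pairwise {S : Finset (ZMod N)} {v : List (ZMod N)}
    (hv : v.Pairwise (MayPrecede S)) (h₁ : ∀ p, p ∈ v → p - 1 ∉ v → p ∈ S)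
    (h₂ : ∀ p, p ∉ v → p - 1 ∈ v → p ∉ S) {T : Finset (ZMod N)}
    (hT : ∀ p, p ∈ T ↔ (p ∉ v ∧ p - 1 ∈ v) ∨ ((p ∈ v ↔ p - 1 ∈ v) ∧ p ∈ S)) :
    Admissible v T ∧ target v T = S := by
  induction v generalizing T with
  | nil => exact ⟨trivial, by ext p; simp [hT]⟩
  | cons i v ih =>
    obtain ⟨h3, h4⟩ := List.pairwise_cons.1 hv
    have hi : i ∉ v := fun h => (h3 i h).1 rfl
    have hi1 : i - 1 ≠ i := fun h => ne_add_one i (sub_eq_iff_eq_add.1 h)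
    have hi2 := ne_add_one i
    have h5 : i + 1 ∈ v → i + 1 ∈ S := fun h => (h3 _ h).2.2 rfl
    have h6 : i - 1 ∈ v → i ∉ S := fun h => (h3 _ h).2.1 (by ring)
    have h7 := h₁ i
    have h8 := h₂ (i + 1)
    have hsub : ∀ p, p - 1 = i ↔ p = i + 1 := fun p => sub_eq_iff_eq_add
    simp only [List.mem_cons, hsub, add_sub_cancel_right] at h7 h8 hT h₁ h₂
    have hT1 := hT (i + 1)
    have hT2 := hT i
    refine (ih h4 (fun p h h' => ?_) (fun p h h' => ?_) (T := move i T) (fun p => ?_)).imp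
      (fun h => ⟨⟨?_, ?_⟩, h⟩) id
    · by_cases hp : p = i + 1
      · exact hp ▸ h5 (hp ▸ h)
      · exact h₁ p (Or.inr h) (by simp [hp, h'])
    · by_cases hp : p = i
      · exact hp ▸ h6 (hp ▸ h')
      · exact h₂ p (by simp [hp, h]) (Or.inr h')
    · rw [mem_move]
      by_cases hp : p = i
      · subst hp; grind
      · by_cases hp' : p = i + 1
        · subst hp'
          rw [add_sub_cancel_right]
          grind
        · simp [hp, hp', hT]
    · rw [hT1, add_sub_cancel_right]; grind
    · rw [hT2]; grind

theorem admissible_of_pairwise {S : Finset (ZMod N)} {w : List (ZMod N)}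
    (hw : w.Pairwise (MayPrecede S)) (h : ∀ p, p ∈ w) : Admissible w S ∧ target w S = S :=
  admissible_suffix_of_pairwise hw (by simp [h]) (by simp [h]) (by simp [h])

/-- A word that contains each letter once and brings `S` back to itself acts as an elementary
matrix. -/
theorem rep_word_loop (K : Type*) [Field K] [NeZero N] {S : Finset (ZMod N)} {w : List (ZMod N)}
    (hw : w.Pairwise (MayPrecede S)) (h : ∀ p, p ∈ w) :
    rep K (word K w) = Matrix.single S S Polynomial.X := by
  classical
  obtain ⟨h1, h2⟩ := admissible_of_pairwise hw h
  have h3 : w.count 0 = 1 :=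
    List.count_eq_one_of_mem (hw.imp fun h => h.1) (h 0)
  ext1 U T
  rw [rep_word, h3, pow_one, Matrix.single_apply]
  congr 1
  refine propext ⟨fun h4 => ?_, ?_⟩
  -- Every position is touched, so the word is admissible for one configuration only.
  · have : S = U := Finset.ext fun p => h1.eq_of_mem h4.1 (Or.inl (h p))
    subst this
    exact ⟨rfl, by rw [← h4.2, h2]⟩
  · rintro ⟨rfl, rfl⟩
    exact ⟨h1, h2⟩

/-- The empty word has the same source, target and winding number. -/
theorem Admissible.eq_nil_of_target_eq {w : List (ZMod N)} {S : Finset (ZMod N)}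
    (h : Admissible w S) (ht : target w S = S) (h0 : w.count 0 = 0) : w = [] :=
  List.nil_perm.1 (Admissible.perm (w := []) trivial h ht.symm h0.symm)

end Loops

/-! ### Sorted entries and the index word of `a(Î)` -/

section Entries

theorem entry_mem {I : Finset ℕ} {s : ℕ} (hs : 1 ≤ s) (hs' : s ≤ I.card) : entry I s ∈ I := by
  have h1 : s - 1 < (I.sort (· ≤ ·)).length := by simp; omega
  rw [entry, List.getD_eq_getElem _ _ h1]
  exact (Finset.mem_sort _).1 (List.getElem_mem h1)

theorem exists_entry_eq {I : Finset ℕ} {x : ℕ} (hx : x ∈ I) :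
    ∃ s, 1 ≤ s ∧ s ≤ I.card ∧ entry I s = x := by
  obtain ⟨n, hn, rfl⟩ := List.getElem_of_mem ((Finset.mem_sort (· ≤ ·)).2 hx)
  refine ⟨n + 1, by omega, by simpa using hn, ?_⟩
  rw [entry, List.getD_eq_getElem]
  rfl

theorem entry_le (I : Finset ℕ) {s r : ℕ} (hs : 1 ≤ s) (hsr : s ≤ r) (hr : r ≤ I.card) :
    entry I s ≤ entry I r := by
  rcases hsr.eq_or_lt with rfl | h
  · rfl
  · exact (entry_lt I hs h hr).le

/-- No element of `I` lies strictly between consecutive entries. -/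
theorem notMem_of_entry_lt {I : Finset ℕ} {s x : ℕ} (hs : s ≤ I.card) (h1 : entry I s < x)
    (h2 : s < I.card → x < entry I (s + 1)) : x ∉ I := by
  intro hx
  obtain ⟨r, hr, hr', rfl⟩ := exists_entry_eq hx
  rcases le_or_gt r s with h | h
  · exact absurd (entry_le I hr h hs) (by omega)
  · have h3 := h2 (by omega)
    exact absurd (entry_le I (s := s + 1) (by omega) h hr') (by omega)

/-- The numbers strictly between `p` and `r`, in decreasing order. -/
def descRange (p r : ℕ) : List ℕ := (List.range' (p + 1) (r - (p + 1))).reverse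

theorem mem_descRange {p r x : ℕ} : x ∈ descRange p r ↔ p < x ∧ x < r := by
  rw [descRange, List.mem_reverse, List.mem_range'_1]; omega

theorem pairwise_descRange (p r : ℕ) : (descRange p r).Pairwise (· > ·) := by
  rw [descRange, List.pairwise_reverse]
  exact List.pairwise_lt_range'

/-- The indices in `a(Î)` that are not in `I`. -/
def hatVacant (N : ℕ) (I : Finset ℕ) : List ℕ :=
  descRange (entry I I.card) (entry I 1 + N) ++
    (List.range' 1 (I.card - 1)).flatMap fun s => descRange (entry I s) (entry I (s + 1))

/-- The indices in `a(Î)` that are in `I`. -/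
def hatOccupied (I : Finset ℕ) (l : ℕ) : List ℕ :=
  (List.range' (l + 1) (I.card - l)).map (entry I) ++ (List.range' 1 l).map (entry I)

theorem monomial_eq_word (K : Type*) [Field K] (N : ℕ) (js : List ℕ) :
    monomial K N js = word K (js.map ((↑) : ℕ → ZMod N)) := by
  rw [monomial, word]
  congr 2
  exact (List.map_eq_flatMap).symm

theorem hatMonomial_eq_word (K : Type*) [Field K] (N : ℕ) (I : Finset ℕ) (l : ℕ) :
    hatMonomial K N I l =
      word K ((hatVacant N I ++ hatOccupied I l).map ((↑) : ℕ → ZMod N)) := by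
  have h : ∀ L : List ℕ, (L.map fun s => descMonomial K N (entry I s) (entry I (s + 1))).prod =
      word K ((L.flatMap fun s => descRange (entry I s) (entry I (s + 1))).map
        ((↑) : ℕ → ZMod N)) := by
    intro L
    induction L with
    | nil => simp
    | cons s L ih =>
      rw [List.map_cons, List.prod_cons, ih, List.flatMap_cons, List.map_append, word_append,
        descMonomial, monomial_eq_word, descRange]
  rw [hatMonomial, h, descMonomial, monomial_eq_word, monomial_eq_word, monomial_eq_word,
    hatVacant, hatOccupied]
  simp only [List.map_append, word_append, descRange, mul_assoc]

/-- Used mostly with `b = entry I 1`: all indices of `a(Î)`, as written, lie in the window from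
`i_1` to `i_1 + N - 1`. -/
theorem natCast_inj_of_window {N b x y : ℕ} (hx : b ≤ x) (hx' : x < b + N) (hy : b ≤ y)
    (hy' : y < b + N) (h : (x : ZMod N) = y) : x = y := by
  refine ((ZMod.natCast_eq_natCast_iff _ _ _).1 h).eq_of_abs_lt ?_
  rw [abs_lt]; omega

variable {N : ℕ} {I : Finset ℕ}

theorem mem_window (hI : I ⊆ Finset.Icc 1 N) {x : ℕ} (hx : x ∈ I) :
    entry I 1 ≤ x ∧ x < entry I 1 + N := by
  obtain ⟨s, hs, hs', rfl⟩ := exists_entry_eq hx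
  have h1 := entry_le I le_rfl hs hs'
  have h2 := Finset.mem_Icc.1 (hI hx)
  have h3 := Finset.mem_Icc.1 (hI (entry_mem le_rfl (hs.trans hs')))
  omega

/-- The configuration with particles at the positions in `I`. -/
def config (N : ℕ) (I : Finset ℕ) : Finset (ZMod N) := I.image (↑)

theorem natCast_mem_config (hI : I ⊆ Finset.Icc 1 N) {x : ℕ} (hx : entry I 1 ≤ x)
    (hx' : x < entry I 1 + N) : (x : ZMod N) ∈ config N I ↔ x ∈ I := by
  refine ⟨fun h => ?_, fun h => Finset.mem_image_of_mem _ h⟩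
  obtain ⟨y, hy, hxy⟩ := Finset.mem_image.1 h
  have := mem_window hI hy
  rwa [← natCast_inj_of_window this.1 this.2 hx hx' hxy]

theorem mem_hatVacant (hI : I ⊆ Finset.Icc 1 N) (h1 : 1 ≤ I.card) {x : ℕ}
    (hx : x ∈ hatVacant N I) : entry I 1 < x ∧ x < entry I 1 + N ∧ x ∉ I := by
  rw [hatVacant, List.mem_append, List.mem_flatMap] at hx
  rcases hx with hx | ⟨s, hs, hx⟩
  · rw [mem_descRange] at hx
    have := entry_le I le_rfl h1 le_rfl
    exact ⟨by omega, hx.2, notMem_of_entry_lt le_rfl hx.1 (by simp)⟩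
  · rw [List.mem_range'_1] at hs
    rw [mem_descRange] at hx
    have h2 := entry_le I (s := 1) (r := s) le_rfl (by omega) (by omega)
    have h3 := mem_window hI (entry_mem (I := I) (s := s + 1) (by omega) (by omega))
    exact ⟨by omega, by omega, notMem_of_entry_lt (by omega) hx.1 fun _ => hx.2⟩

theorem mem_hatOccupied {l x : ℕ} (hl : l ≤ I.card) (hx : x ∈ hatOccupied I l) : x ∈ I := by
  simp only [hatOccupied, List.mem_append, List.mem_map, List.mem_range'_1] at hx
  rcases hx with ⟨s, hs, rfl⟩ | ⟨s, hs, rfl⟩ <;> exact entry_mem (by omega) (by omega)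

/-- Each block decreases, the leading block lies above `i_k` and all others below it, and distinct
blocks are separated by an element of `I`. -/
theorem pairwise_hatVacant (h1 : 1 ≤ I.card) :
    (hatVacant N I).Pairwise fun x y => x ≠ y ∧ y ≠ x + 1 := by
  have hdesc : ∀ p r, (descRange p r).Pairwise fun x y => x ≠ y ∧ y ≠ x + 1 := fun p r =>
    (pairwise_descRange p r).imp fun h => by omega
  rw [hatVacant, List.pairwise_append, List.pairwise_flatMap]
  refine ⟨hdesc _ _, ⟨fun _ _ => hdesc _ _, ?_⟩, ?_⟩
  · refine List.Pairwise.imp_of_mem ?_ List.pairwise_lt_range'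
    intro s r hs hr hsr x hx y hy
    rw [mem_descRange] at hx hy
    rw [List.mem_range'_1] at hs hr
    have := entry_le I (s := s + 1) (r := r) (by omega) hsr (by omega)
    omega
  · intro x hx y hy
    obtain ⟨s, hs, hy⟩ := List.mem_flatMap.1 hy
    rw [mem_descRange] at hx hy
    rw [List.mem_range'_1] at hs
    have := entry_le I (s := s + 1) (r := I.card) (by omega) (by omega) le_rfl
    omega

theorem IsGap.le_card {l : ℕ} (h : IsGap N I l) : l ≤ I.card := by
  rcases h.2 with h | h <;> omega

theorem pairwise_hatOccupied (hI : I ⊆ Finset.Icc 1 N) {l : ℕ} (hl : IsGap N I l) :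
    (hatOccupied I l).Pairwise fun x y =>
      x ≠ y ∧ x ≠ y + 1 ∧ ¬ (x = entry I 1 ∧ y + 1 = entry I 1 + N) := by
  have hlk := hl.le_card
  have hl1 := hl.1
  have hmem : ∀ {s}, 1 ≤ s → s ≤ I.card → 1 ≤ entry I s ∧ entry I s ≤ N := fun h h' =>
    Finset.mem_Icc.1 (hI (entry_mem h h'))
  -- This excludes the wrap-around: if `i_1 + N - 1` is in `I`, it lies in the factor that precedes
  -- `i_1`.
  have hlast : entry I l + 1 < entry I 1 + N := by
    rcases hl.2 with ⟨h, h'⟩ | ⟨h, h'⟩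
    · have h2 := hmem (s := l + 1) (by omega) (by omega)
      have h3 := hmem (s := 1) (by omega) (by omega)
      omega
    · rw [h]; exact h'
  rw [hatOccupied, List.pairwise_append, List.pairwise_map, List.pairwise_map]
  refine ⟨?_, ?_, ?_⟩
  · refine List.Pairwise.imp_of_mem ?_ List.pairwise_lt_range'
    intro s r hs hr hsr
    rw [List.mem_range'_1] at hs hr
    have h2 := entry_lt I (s := s) (r := r) (by omega) hsr (by omega)
    have h3 := entry_lt I (s := 1) (r := s) le_rfl (by omega) (by omega)
    omega
  · refine List.Pairwise.imp_of_mem ?_ List.pairwise_lt_range'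
    intro s r hs hr hsr
    rw [List.mem_range'_1] at hs hr
    have h2 := entry_lt I (s := s) (r := r) (by omega) hsr (by omega)
    have h3 := entry_le I (s := r) (r := l) (by omega) (by omega) hlk
    omega
  · simp only [List.mem_map, List.mem_range'_1]
    rintro _ ⟨s, hs, rfl⟩ _ ⟨r, hr, rfl⟩
    have hk : l < I.card := by omega
    have h2 : entry I l + 1 < entry I (l + 1) := by
      rcases hl.2 with h | h
      · exact h.2
      · omega
    have h3 := entry_le I (s := l + 1) (r := s) (by omega) (by omega) (by omega)
    have h4 := entry_le I (s := r) (r := l) (by omega) (by omega) hlk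
    have h5 := entry_le I (s := 1) (r := r) (by omega) (by omega) (by omega)
    omega

theorem exists_mem_hat (hI : I ⊆ Finset.Icc 1 N) (h1 : 1 ≤ I.card) {l : ℕ} (hl : IsGap N I l)
    (p : ZMod N) : ∃ x ∈ hatVacant N I ++ hatOccupied I l, (x : ZMod N) = p := by
  have hb := Finset.mem_Icc.1 (hI (entry_mem le_rfl h1))
  have : NeZero N := ⟨by omega⟩
  obtain ⟨x, hx, hx', rfl⟩ : ∃ x : ℕ, entry I 1 ≤ x ∧ x < entry I 1 + N ∧ (x : ZMod N) = p := by
    refine ⟨entry I 1 + (p - (entry I 1 : ZMod N)).val, by omega, ?_, by simp⟩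
    have := ZMod.val_lt (p - (entry I 1 : ZMod N))
    omega
  refine ⟨x, ?_, rfl⟩
  have hlk := hl.le_card
  have hl1 := hl.1
  rw [List.mem_append]
  by_cases hxI : x ∈ I
  · right
    obtain ⟨s, hs, hs', rfl⟩ := exists_entry_eq hxI
    rw [hatOccupied, List.mem_append]
    rcases le_or_gt s l with h | h
    · exact Or.inr (List.mem_map_of_mem (List.mem_range'_1.2 (by omega)))
    · exact Or.inl (List.mem_map_of_mem (List.mem_range'_1.2 (by omega)))
  · left
    have hne : ∀ s, 1 ≤ s → s ≤ I.card → x ≠ entry I s := fun s hs hs' h =>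
      hxI (h ▸ entry_mem hs hs')
    rw [hatVacant, List.mem_append, List.mem_flatMap]
    rcases lt_or_ge (entry I I.card) x with h | h
    · exact Or.inl (mem_descRange.2 ⟨h, hx'⟩)
    · right
      -- Descending through the entries finds the consecutive pair that encloses `x`.
      have key : ∀ s, 1 ≤ s → s ≤ I.card → x ≤ entry I s →
          ∃ a ∈ List.range' 1 (I.card - 1), x ∈ descRange (entry I a) (entry I (a + 1)) := by
        intro s hs
        induction s, hs using Nat.le_induction with
        | base => intro h2 h3; exact absurd (le_antisymm h3 hx) (hne 1 le_rfl h2)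
        | succ s hs ih =>
          intro h2 h3
          rcases lt_or_ge (entry I s) x with h4 | h4
          · refine ⟨s, List.mem_range'_1.2 (by omega), mem_descRange.2 ⟨h4, ?_⟩⟩
            exact lt_of_le_of_ne h3 (hne _ (by omega) h2)
          · exact ih (by omega) h4
      exact key _ h1 le_rfl h

/-- Vacant letters all come before occupied ones, which is always permitted; within each group only
cyclic neighbours matter, and `hsucc` says when these are neighbours in the window. -/
theorem pairwise_hat (hI : I ⊆ Finset.Icc 1 N) (h1 : 1 ≤ I.card) {l : ℕ} (hl : IsGap N I l) :
    ((hatVacant N I ++ hatOccupied I l).map ((↑) : ℕ → ZMod N)).Pairwise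
      (MayPrecede (config N I)) := by
  have hb := Finset.mem_Icc.1 (hI (entry_mem le_rfl h1))
  have hvac : ∀ x ∈ hatVacant N I, (x : ZMod N) ∉ config N I := fun x hx => by
    have := mem_hatVacant hI h1 hx
    rw [natCast_mem_config hI this.1.le this.2.1]
    exact this.2.2
  have hocc : ∀ x ∈ hatOccupied I l, (x : ZMod N) ∈ config N I := fun x hx =>
    Finset.mem_image_of_mem _ (mem_hatOccupied hl.le_card hx)
  have hsucc : ∀ {x y : ℕ}, entry I 1 ≤ x → x < entry I 1 + N → entry I 1 ≤ y →
      y < entry I 1 + N → (y : ZMod N) = x + 1 →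
      y = x + 1 ∨ (y = entry I 1 ∧ x + 1 = entry I 1 + N) := by
    intro x y hx hx' hy hy' h
    rcases lt_or_ge (x + 1) (entry I 1 + N) with h2 | h2
    · exact Or.inl (natCast_inj_of_window hy hy' (by omega) h2 (by push_cast; exact h))
    · have h3 : x + 1 = entry I 1 + N := by omega
      refine Or.inr ⟨natCast_inj_of_window hy hy' le_rfl (by omega) ?_, h3⟩
      rw [h, ← Nat.cast_add_one, h3]; simp
  rw [List.pairwise_map, List.pairwise_append]
  refine ⟨?_, ?_, ?_⟩
  · refine (pairwise_hatVacant h1).imp_of_mem fun {x y} hx hy h => ?_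
    have h2 := mem_hatVacant hI h1 hx
    have h3 := mem_hatVacant hI h1 hy
    refine ⟨fun h4 => h.1 (natCast_inj_of_window h2.1.le h2.2.1 h3.1.le h3.2.1 h4),
      fun _ => hvac x hx, fun h4 => ?_⟩
    have := hsucc h2.1.le h2.2.1 h3.1.le h3.2.1 h4
    omega
  · refine (pairwise_hatOccupied hI hl).imp_of_mem fun {x y} hx hy h => ?_
    have h2 := mem_window hI (mem_hatOccupied hl.le_card hx)
    have h3 := mem_window hI (mem_hatOccupied hl.le_card hy)
    refine ⟨fun h4 => h.1 (natCast_inj_of_window h2.1 h2.2 h3.1 h3.2 h4),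
      fun h4 => ?_, fun _ => hocc y hy⟩
    have := hsucc h3.1 h3.2 h2.1 h2.2 h4
    omega
  · intro x hx y hy
    have h2 := hvac x hx
    have h3 := hocc y hy
    exact ⟨fun h => h2 (h ▸ h3), fun _ => h2, fun _ => h3⟩

theorem rep_hatMonomial (K : Type*) [Field K] [NeZero N] [Fact (3 ≤ N)]
    (hI : I ⊆ Finset.Icc 1 N) (h1 : 1 ≤ I.card) {l : ℕ} (hl : IsGap N I l) :
    rep K (hatMonomial K N I l) = Matrix.single (config N I) (config N I) Polynomial.X := by
  rw [hatMonomial_eq_word, rep_word_loop K (pairwise_hat hI h1 hl)]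
  intro p
  obtain ⟨x, hx, rfl⟩ := exists_mem_hat hI h1 hl p
  exact List.mem_map_of_mem hx

theorem config_injOn : Set.InjOn (config N) {I | I ⊆ Finset.Icc 1 N} := by
  have h : Set.InjOn ((↑) : ℕ → ZMod N) (Set.Icc 1 N) := fun x hx y hy =>
    natCast_inj_of_window (b := 1) hx.1 (by have := hx.2; omega) hy.1 (by have := hy.2; omega)
  intro I hI J hJ hIJ
  have := h.image_eq_image_iff (s₁ := I) (s₂ := J) (by simpa using Finset.coe_subset.2 hI)
    (by simpa using Finset.coe_subset.2 hJ)
  rw [← Finset.coe_inj, ← this, ← Finset.coe_image, ← Finset.coe_image]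
  exact congrArg _ hIJ

theorem card_config (hI : I ⊆ Finset.Icc 1 N) : (config N I).card = I.card := by
  refine Finset.card_image_of_injOn fun x hx y hy => ?_
  have h1 := Finset.mem_Icc.1 (hI hx)
  have h2 := Finset.mem_Icc.1 (hI hy)
  exact natCast_inj_of_window (b := 1) (by omega) (by omega) (by omega) (by omega)

theorem exists_config_eq [NeZero N] (S : Finset (ZMod N)) :
    ∃ I ⊆ Finset.Icc 1 N, config N I = S := by
  classical
  refine ⟨(Finset.Icc 1 N).filter fun x => (x : ZMod N) ∈ S, Finset.filter_subset _ _, ?_⟩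
  ext p
  simp only [config, Finset.mem_image, Finset.mem_filter, Finset.mem_Icc]
  constructor
  · rintro ⟨x, hx, rfl⟩; exact hx.2
  · intro hp
    have := ZMod.val_lt (p - 1)
    refine ⟨(p - 1).val + 1, ⟨⟨by omega, by omega⟩, ?_⟩, ?_⟩ <;> simp [hp]

end Entries

/-! ### Central elements -/

section Invariance

/-- A function of configurations that is invariant under moves depends only on the number of
particles. -/
theorem eq_of_card_eq_of_move {N : ℕ} [NeZero N] {α : Type*} {f : Finset (ZMod N) → α}
    (hf : ∀ i S, i + 1 ∈ S → i ∉ S → f (move i S) = f S) {S T : Finset (ZMod N)}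
    (h : S.card = T.card) : f S = f T := by
  obtain ⟨n, rfl⟩ := Nat.exists_eq_succ_of_ne_zero (NeZero.ne N)
  -- Exchanging the contents of `i` and `i + 1` changes nothing or is a move, forwards or backwards.
  -- Such exchanges generate all permutations, which act transitively on subsets of a given size.
  have hswap : ∀ (i : ZMod (n + 1)) S, i ≠ i + 1 → f (S.image (Equiv.swap i (i + 1))) = f S := by
    intro i S hi
    by_cases h1 : i ∈ S <;> by_cases h2 : i + 1 ∈ S
    · congr 1
      ext p
      simp only [Finset.mem_image, Equiv.swap_apply_def]
      grind
    · rw [← hf i (S.image (Equiv.swap i (i + 1)))]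
      · congr 1
        ext p
        simp only [mem_move, Finset.mem_image, Equiv.swap_apply_def]
        grind
      · exact Finset.mem_image.2 ⟨i, h1, by simp⟩
      · simp only [Finset.mem_image, Equiv.swap_apply_def]
        grind
    · rw [← hf i S h2 h1]
      congr 1
      ext p
      simp only [mem_move, Finset.mem_image, Equiv.swap_apply_def]
      grind
    · congr 1
      ext p
      simp only [Finset.mem_image, Equiv.swap_apply_def]
      grind
  let g : Finset (Fin (n + 1)) → α := f
  have hperm : ∀ (σ : Equiv.Perm (Fin (n + 1))) (S : Finset (Fin (n + 1))),
      g (S.image σ) = g S := by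
    intro σ
    have hσ : σ ∈ Submonoid.closure (Set.range fun i : Fin n => Equiv.swap i.castSucc i.succ) := by
      rw [Equiv.Perm.mclosure_swap_castSucc_succ]; trivial
    induction hσ using Submonoid.closure_induction with
    | mem σ hσ =>
      obtain ⟨i, rfl⟩ := hσ
      intro S
      have h1 : i.succ = i.castSucc + 1 := (Fin.coeSucc_eq_succ).symm
      have := hswap i.castSucc S (by
        intro h2
        exact (Fin.castSucc_lt_succ (i := i)).ne (h2.trans h1.symm))
      refine Eq.trans ?_ this
      change f _ = f _
      congr 1
      simp only [h1]
      rfl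
    | one => intro S; rw [Equiv.Perm.coe_one, Finset.image_id]
    | mul σ τ _ _ h1 h2 =>
      intro S
      rw [← h2 S, ← h1 (S.image τ), Finset.image_image]
      rfl
  let S' : Finset (Fin (n + 1)) := S
  let T' : Finset (Fin (n + 1)) := T
  let e : {x // x ∈ S'} ≃ {x // x ∈ T'} := Finset.equivOfCardEq h
  have h1 : S'.image e.extendSubtype = T' := by
    refine Finset.eq_of_subset_of_card_le (fun y hy => ?_) ?_
    · obtain ⟨x, hx, rfl⟩ := Finset.mem_image.1 hy
      exact e.extendSubtype_mem x hx
    · rw [Finset.card_image_of_injective _ (Equiv.injective _)]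
      exact h.ge
  exact (hperm e.extendSubtype S').symm.trans (congrArg f h1)

end Invariance

/-- The eigenvalue of `t_k` on a configuration. -/
noncomputable def eigenvalue (K : Type*) [Field K] (N k : ℕ) (S : Finset (ZMod N)) : K[X] :=
  if S.card = k then Polynomial.C ((-1) ^ (k - 1)) * Polynomial.X else 0

/-- `gap` selects a gap of every nonempty proper subset of the circle. -/
def IsGapChoice (N : ℕ) (gap : Finset ℕ → ℕ) : Prop :=
  ∀ I : Finset ℕ, I ⊆ Finset.Icc 1 N → 1 ≤ I.card → I.card ≤ N - 1 → IsGap N I (gap I)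

section Center

variable {N : ℕ} [NeZero N]

theorem eq_of_card_eq_zero_or {S T : Finset (ZMod N)} (hS : S.card = 0 ∨ S.card = N)
    (h : S.card = T.card) : S = T := by
  rcases hS with h0 | h0
  · rw [Finset.card_eq_zero.1 h0, Finset.card_eq_zero.1 (h.symm.trans h0)]
  · rw [Finset.card_eq_iff_eq_univ S |>.1 (by rw [h0, ZMod.card]),
      Finset.card_eq_iff_eq_univ T |>.1 (by rw [← h, h0, ZMod.card])]

theorem card_config_cases (S : Finset (ZMod N)) :
    (S.card = 0 ∨ S.card = N) ∨ (1 ≤ S.card ∧ S.card ≤ N - 1) := by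
  have := Finset.card_le_univ S
  rw [ZMod.card] at this
  omega

variable {K : Type*} [Field K] [Fact (3 ≤ N)]

theorem rep_eq_zero_of_card_ne (x : AffineNilTL K N) {S T : Finset (ZMod N)}
    (h : S.card ≠ T.card) : rep K x S T = 0 := by
  classical
  have hx : x ∈ Submodule.span K (Set.range (word K (N := N))) := by
    rw [span_range_word]; trivial
  induction hx using Submodule.span_induction with
  | mem x hx =>
    obtain ⟨w, rfl⟩ := hx
    rw [rep_word, if_neg]
    rintro ⟨h1, rfl⟩
    exact h h1.card_target.symm
  | zero => simp
  | add x y _ _ hx hy => simp [hx, hy]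
  | smul c x _ hx => simp [hx]

/-- A nonempty loop uses the letter `0`, so the constant term of a diagonal entry sees only the
empty word. -/
theorem coeff_zero_rep (x : AffineNilTL K N) (S T : Finset (ZMod N)) :
    (rep K x S S).coeff 0 = (rep K x T T).coeff 0 := by
  classical
  have key : ∀ w : List (ZMod N), ∀ S, (rep K (word K w) S S).coeff 0 = if w = [] then 1 else 0 := by
    intro w S
    rw [rep_word]
    by_cases hw : w = []
    · simp [hw]
    · rw [if_neg hw]
      split_ifs with h
      · have : 0 ≠ w.count 0 := fun h0 => hw (h.1.eq_nil_of_target_eq h.2 h0.symm)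
        rw [Polynomial.coeff_X_pow, if_neg this]
      · simp
  have hx : x ∈ Submodule.span K (Set.range (word K (N := N))) := by
    rw [span_range_word]; trivial
  induction hx using Submodule.span_induction with
  | mem x hx =>
    obtain ⟨w, rfl⟩ := hx
    rw [key, key]
  | zero => simp
  | add x y _ _ hx hy => simp [hx, hy]
  | smul c x _ hx => simp [hx]

/-- On an empty or full circle no particle can move, so only the empty word acts. -/
theorem rep_eq_C (x : AffineNilTL K N) {S : Finset (ZMod N)} (hS : S.card = 0 ∨ S.card = N) :
    rep K x S S = Polynomial.C ((rep K x S S).coeff 0) := by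
  classical
  have hx : x ∈ Submodule.span K (Set.range (word K (N := N))) := by
    rw [span_range_word]; trivial
  induction hx using Submodule.span_induction with
  | mem x hx =>
    obtain ⟨w, rfl⟩ := hx
    rw [rep_word]
    cases w with
    | nil => simp
    | cons i w =>
      rw [if_neg]
      · simp
      · rintro ⟨⟨⟨h1, h2⟩, -⟩, -⟩
        rcases hS with h | h
        · rw [Finset.card_eq_zero] at h
          simp [h] at h1
        · rw [Finset.card_eq_iff_eq_univ S |>.1 (by rw [h, ZMod.card])] at h2
          exact h2 (Finset.mem_univ _)
  | zero => simp
  | add x y _ _ hx hy => rw [map_add, Matrix.add_apply, hx, hy]; simp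
  | smul c x _ hx => rw [map_smul, Matrix.smul_apply, hx]; simp

/-- Central elements act diagonally. -/
theorem rep_center_apply_ne {x : AffineNilTL K N}
    (hx : x ∈ Subalgebra.center K (AffineNilTL K N)) {S T : Finset (ZMod N)} (h : S ≠ T) :
    rep K x S T = 0 := by
  classical
  by_cases hc : S.card = T.card
  swap
  · exact rep_eq_zero_of_card_ne x hc
  rcases card_config_cases S with hS | ⟨h1, h2⟩
  · exact absurd (eq_of_card_eq_zero_or hS hc) h
  obtain ⟨I, hI, rfl⟩ := exists_config_eq S
  rw [card_config hI] at h1 h2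
  obtain ⟨l, hl⟩ := exists_isGap N I h1 h2
  -- Against `X` times an elementary matrix, the `(S, T)` entry of the commutation relation reads `X
  -- * x_ST = 0`.
  have h3 := congrArg (rep K) (Subalgebra.mem_center_iff.1 hx (hatMonomial K N I l))
  rw [map_mul, map_mul, rep_hatMonomial K hI h1 hl] at h3
  have h4 := congrFun (congrFun h3 (config N I)) T
  rw [Matrix.single_mul_apply_same, Matrix.mul_single_apply_of_ne _ _ _ _ _ h.symm] at h4
  exact (mul_eq_zero.1 h4).resolve_left Polynomial.X_ne_zero

theorem rep_center_move {x : AffineNilTL K N}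
    (hx : x ∈ Subalgebra.center K (AffineNilTL K N)) {i : ZMod N} {S : Finset (ZMod N)}
    (h1 : i + 1 ∈ S) (h2 : i ∉ S) : rep K x (move i S) (move i S) = rep K x S S := by
  classical
  have h3 := congrArg (rep K) (Subalgebra.mem_center_iff.1 hx (word K [i]))
  rw [map_mul, map_mul] at h3
  have h4 := congrFun (congrFun h3 S) (move i S)
  have hadm : Admissible [i] S := ⟨⟨h1, h2⟩, trivial⟩
  rw [Matrix.mul_apply, Matrix.mul_apply, Finset.sum_eq_single (move i S),
    Finset.sum_eq_single S, rep_word, if_pos ⟨hadm, rfl⟩, mul_comm] at h4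
  · exact mul_right_cancel₀ (pow_ne_zero _ Polynomial.X_ne_zero) h4
  · intro U _ hU
    rw [rep_center_apply_ne hx hU.symm, zero_mul]
  · simp
  · intro U _ hU
    rw [rep_center_apply_ne hx hU, mul_zero]
  · simp

theorem rep_center_apply_eq {x : AffineNilTL K N}
    (hx : x ∈ Subalgebra.center K (AffineNilTL K N)) {S T : Finset (ZMod N)}
    (h : S.card = T.card) : rep K x S S = rep K x T T :=
  eq_of_card_eq_of_move (f := fun S => rep K x S S) (fun _ _ h1 h2 => rep_center_move hx h1 h2) h

/-! ### The elements `t_k` -/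

theorem rep_t {gap : Finset ℕ → ℕ} (hgap : IsGapChoice N gap) {k : ℕ} (hk : k ∈ Set.Icc 1 (N - 1)) :
    rep K (t K N gap k) = Matrix.diagonalAlgHom K (eigenvalue K N k) := by
  classical
  have h1 : t K N gap k = ((-1) ^ (k - 1) : K) •
      ∑ I ∈ (Finset.Icc 1 N).powersetCard k, hatMonomial K N I (gap I) := by
    rw [t, Algebra.smul_def]; simp
  have h2 : rep K (t K N gap k) = ((-1) ^ (k - 1) : K) • ∑ I ∈ (Finset.Icc 1 N).powersetCard k,
      Matrix.single (config N I) (config N I) Polynomial.X := by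
    rw [h1, map_smul, map_sum]
    congr 1
    refine Finset.sum_congr rfl fun I hI => ?_
    obtain ⟨hI, hIk⟩ := Finset.mem_powersetCard.1 hI
    exact rep_hatMonomial K hI (hIk ▸ hk.1) (hgap I hI (hIk ▸ hk.1) (hIk ▸ hk.2))
  rw [h2]
  ext1 S T
  rw [Matrix.smul_apply, Matrix.sum_apply, Matrix.diagonalAlgHom_apply]
  obtain ⟨I, hI, rfl⟩ := exists_config_eq S
  by_cases hST : config N I = T
  · subst hST
    rw [Matrix.diagonal_apply_eq, eigenvalue, card_config hI]
    split_ifs with hk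
    · rw [Finset.sum_eq_single I]
      · rw [Matrix.single_apply_same, Polynomial.smul_eq_C_mul]
      · intro J hJ hJI
        refine Matrix.single_apply_of_ne _ _ _ _ _ fun h => hJI ?_
        exact config_injOn (Finset.mem_powersetCard.1 hJ).1 hI h.1
      · intro h; exact absurd (Finset.mem_powersetCard.2 ⟨hI, hk⟩) h
    · rw [Finset.sum_eq_zero, smul_zero]
      intro J hJ
      obtain ⟨hJ, hJk⟩ := Finset.mem_powersetCard.1 hJ
      refine Matrix.single_apply_of_ne _ _ _ _ _ fun h => hk ?_
      rw [← config_injOn hJ hI h.1, hJk]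
  · rw [Matrix.diagonal_apply_ne _ hST, Finset.sum_eq_zero, smul_zero]
    intro J hJ
    exact Matrix.single_apply_of_ne _ _ _ _ _ fun h => hST (h.1.symm.trans h.2)

end Center

open Polynomial in
-- Substituting `±X` is an involution; this undoes the sign in `t_k`.
theorem aeval_C_mul_X_comp {K : Type*} [Field K] {s : K} (hs : s * s = 1) (p : K[X]) :
    aeval (C s * X) (aeval (C s * X) p) = p := by
  rw [← comp_eq_aeval, ← comp_eq_aeval, comp_assoc]
  simp [← mul_assoc, ← C_mul, hs]

/-- Substituting `0` for all variables but one extracts the monomials in that variable. -/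
theorem coeff_aeval_ite {σ K : Type*} [DecidableEq σ] [Field K] (k : σ) (s : K)
    (P : MvPolynomial σ K) (n : ℕ) :
    (MvPolynomial.aeval (fun l => if l = k then Polynomial.C s * Polynomial.X else 0) P).coeff n =
      s ^ n * P.coeff (Finsupp.single k n) := by
  induction P using MvPolynomial.induction_on' with
  | add p q hp hq => rw [map_add, Polynomial.coeff_add, hp, hq, MvPolynomial.coeff_add, mul_add]
  | monomial m a =>
    rw [MvPolynomial.aeval_monomial, MvPolynomial.coeff_monomial, Polynomial.algebraMap_eq,
      Polynomial.coeff_C_mul]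
    by_cases hm : ∀ l, l ≠ k → m l = 0
    · have : m = Finsupp.single k (m k) := by
        ext l
        by_cases hl : l = k
        · subst hl; simp
        · simp [hm l hl, Ne.symm hl]
      rw [this, Finsupp.prod_single_index (by simp), if_pos rfl, mul_pow, ← Polynomial.C_pow,
        Polynomial.coeff_C_mul, Polynomial.coeff_X_pow]
      by_cases hn : n = m k
      · subst hn; simp [mul_comm]
      · have h1 : Finsupp.single k (m k) ≠ Finsupp.single k n := fun h =>
          hn (Finsupp.single_injective k h).symm
        simp [hn, h1]
    · push Not at hm
      obtain ⟨l, hl, hml⟩ := hm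
      have h1 : m ≠ Finsupp.single k n := by
        rintro rfl
        exact hml (by simp [Ne.symm hl])
      rw [if_neg h1, Finsupp.prod, Finset.prod_eq_zero (Finsupp.mem_support_iff.2 hml)]
      · simp
      · simp [hl, hml]

/-! ### Structure of the center -/

section Decomposition

variable {K : Type*} [Field K] {N : ℕ} {gap : Finset ℕ → ℕ}

theorem exists_of_mem_summand {k : Fin N} (hk : (k : ℕ) ≠ 0) {x : AffineNilTL K N}
    (hx : x ∈ summand K N gap k) :
    ∃ g : K[X], x = t K N gap k * Polynomial.aeval (t K N gap k) g := by
  rw [summand, if_neg hk] at hx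
  obtain ⟨y, hy, rfl⟩ := hx
  rw [Algebra.adjoin_singleton_eq_range_aeval] at hy
  obtain ⟨g, rfl⟩ := hy
  exact ⟨g, rfl⟩

theorem aeval_mem_adjoin_singleton {A : Type*} [Ring A] [Algebra K A] (a : A) (p : K[X]) :
    Polynomial.aeval a p ∈ Algebra.adjoin K {a} := by
  rw [Algebra.adjoin_singleton_eq_range_aeval]
  exact ⟨p, rfl⟩

variable [NeZero N] [Fact (3 ≤ N)]

/-- The eigenvalue depends only on the particle number, which every element preserves. -/
theorem t_mem_center (hgap : IsGapChoice N gap) {k : ℕ} (hk : k ∈ Set.Icc 1 (N - 1)) :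
    t K N gap k ∈ Subalgebra.center K (AffineNilTL K N) := by
  rw [Subalgebra.mem_center_iff]
  intro y
  apply rep_injective K
  rw [map_mul, map_mul, rep_t hgap hk]
  ext1 S T
  rw [Matrix.diagonalAlgHom_apply, Matrix.diagonal_mul, Matrix.mul_diagonal]
  by_cases h : S.card = T.card
  · rw [eigenvalue, eigenvalue, h, mul_comm]
  · rw [rep_eq_zero_of_card_ne y h, mul_zero, zero_mul]

theorem t_mul_t (hgap : IsGapChoice N gap) {k l : ℕ} (hk : k ∈ Set.Icc 1 (N - 1)) (hl : l ∈ Set.Icc 1 (N - 1))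
    (hkl : k ≠ l) : t K N gap k * t K N gap l = 0 := by
  apply rep_injective K
  rw [map_mul, rep_t hgap hk, rep_t hgap hl, ← map_mul, map_zero]
  refine (congrArg _ (funext fun S => ?_)).trans (map_zero _)
  rw [Pi.mul_apply, eigenvalue, eigenvalue, Pi.zero_apply]
  split_ifs with h1 h2
  · exact absurd (h1.symm.trans h2) hkl
  all_goals simp

theorem rep_aeval_t (hgap : IsGapChoice N gap) {k : ℕ} (hk : k ∈ Set.Icc 1 (N - 1)) (p : K[X]) :
    rep K (Polynomial.aeval (t K N gap k) p) =
      Matrix.diagonalAlgHom K fun S => Polynomial.aeval (eigenvalue K N k S) p := by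
  rw [← Polynomial.aeval_algHom_apply, rep_t hgap hk, Polynomial.aeval_algHom_apply]
  refine congrArg _ (funext fun S => ?_)
  exact (Polynomial.aeval_algHom_apply (Pi.evalAlgHom K (fun _ => K[X]) S) _ p).symm

theorem exists_center_decomposition (hgap : IsGapChoice N gap) {x : AffineNilTL K N}
    (hx : x ∈ Subalgebra.center K (AffineNilTL K N)) :
    ∃ (c : K) (g : ℕ → K[X]), x = algebraMap K _ c + ∑ k ∈ Finset.Icc 1 (N - 1),
      t K N gap k * Polynomial.aeval (t K N gap k) (g k) := by
  classical
  let S₀ : ℕ → Finset (ZMod N) := fun k => config N (Finset.Icc 1 k)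
  have hS₀ : ∀ {k}, k ≤ N → (S₀ k).card = k := fun {k} hk => by
    rw [card_config (Finset.Icc_subset_Icc_right hk)]; simp
  let s : ℕ → K := fun k => (-1) ^ (k - 1)
  have hs : ∀ k, s k * s k = 1 := fun k => by
    simp [s, ← mul_pow]
  let c := (rep K x ∅ ∅).coeff 0
  let r : ℕ → K[X] := fun k => (rep K x (S₀ k) (S₀ k)).divX
  -- With `s = ±1`, `t_k g(t_k)` has entry `s X g(s X)`; this must equal `X r`, hence `g = s r(s
  -- X)`.
  let g : ℕ → K[X] := fun k =>
    Polynomial.C (s k) * Polynomial.aeval (Polynomial.C (s k) * Polynomial.X) (r k)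
  refine ⟨c, g, rep_injective K ?_⟩
  rw [map_add, map_sum, AlgHom.commutes, ← (Matrix.diagonalAlgHom K).commutes]
  have h1 : ∀ k ∈ Finset.Icc 1 (N - 1),
      rep K (t K N gap k * Polynomial.aeval (t K N gap k) (g k)) = Matrix.diagonalAlgHom K
        (eigenvalue K N k * fun S => Polynomial.aeval (eigenvalue K N k S) (g k)) := by
    intro k hk
    have hk' : k ∈ Set.Icc 1 (N - 1) := Finset.mem_Icc.1 hk
    rw [map_mul (rep K), map_mul (Matrix.diagonalAlgHom K), rep_t hgap hk', rep_aeval_t hgap hk']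
  rw [Finset.sum_congr rfl h1, ← map_sum, ← map_add]
  ext1 S T
  rw [Matrix.diagonalAlgHom_apply]
  by_cases hST : S = T
  swap
  · rw [Matrix.diagonal_apply_ne _ hST, rep_center_apply_ne hx hST]
  subst hST
  rw [Matrix.diagonal_apply_eq, Pi.add_apply, Finset.sum_apply, Pi.algebraMap_apply,
    Polynomial.algebraMap_eq]
  simp only [Pi.mul_apply]
  rcases card_config_cases S with hS | hS
  · rw [Finset.sum_eq_zero, add_zero, rep_eq_C x hS, coeff_zero_rep x S ∅]
    intro k hk
    rw [Finset.mem_Icc] at hk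
    have : N ≠ 0 := NeZero.ne N
    rw [eigenvalue, if_neg (by omega), zero_mul]
  · rw [Finset.sum_eq_single S.card]
    · have h2 : Polynomial.aeval (eigenvalue K N S.card S) (g S.card) =
          Polynomial.C (s S.card) * r S.card := by
        rw [eigenvalue, if_pos rfl]
        change Polynomial.aeval (Polynomial.C (s S.card) * Polynomial.X) _ = _
        rw [map_mul, aeval_C_mul_X_comp (hs _), Polynomial.aeval_C, Polynomial.algebraMap_eq]
      rw [h2, eigenvalue, if_pos rfl]
      change _ = _ + Polynomial.C (s S.card) * Polynomial.X * _
      have h3 : Polynomial.C (s S.card) * Polynomial.C (s S.card) = 1 := by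
        rw [← Polynomial.C_mul, hs, Polynomial.C_1]
      have h4 : r S.card = (rep K x S S).divX := by
        simp only [r]
        rw [rep_center_apply_eq hx (hS₀ (by omega))]
      rw [h4]
      change _ = Polynomial.C (rep K x ∅ ∅ |>.coeff 0) + _
      rw [← coeff_zero_rep x S ∅]
      calc _ = (rep K x S S).divX * Polynomial.X + Polynomial.C ((rep K x S S).coeff 0) :=
            (Polynomial.divX_mul_X_add _).symm
        _ = _ := by linear_combination (- (rep K x S S).divX * Polynomial.X) * h3
    · intro k _ hk
      rw [eigenvalue, if_neg hk.symm, zero_mul]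
    · intro h
      exact absurd (Finset.mem_Icc.2 hS) h

theorem aeval_t_mem_center (hgap : IsGapChoice N gap) {k : ℕ} (hk : k ∈ Set.Icc 1 (N - 1)) (p : K[X]) :
    Polynomial.aeval (t K N gap k) p ∈ Subalgebra.center K (AffineNilTL K N) :=
  Algebra.adjoin_le (Set.singleton_subset_iff.2 (t_mem_center hgap hk))
    (aeval_mem_adjoin_singleton _ p)

theorem adjoin_t_eq_center (hgap : IsGapChoice N gap) :
    Algebra.adjoin K (t K N gap '' Set.Icc 1 (N - 1)) = Subalgebra.center K (AffineNilTL K N) := by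
  refine le_antisymm (Algebra.adjoin_le ?_) fun x hx => ?_
  · rintro _ ⟨k, hk, rfl⟩
    exact t_mem_center hgap hk
  · obtain ⟨c, g, rfl⟩ := exists_center_decomposition hgap hx
    have ht : ∀ k ∈ Finset.Icc 1 (N - 1),
        t K N gap k ∈ Algebra.adjoin K (t K N gap '' Set.Icc 1 (N - 1)) := fun k hk =>
      Algebra.subset_adjoin ⟨k, Finset.mem_Icc.1 hk, rfl⟩
    refine add_mem (Subalgebra.algebraMap_mem _ c) (sum_mem fun k hk => mul_mem (ht k hk) ?_)
    have hle : Algebra.adjoin K {t K N gap k} ≤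
        Algebra.adjoin K (t K N gap '' Set.Icc 1 (N - 1)) :=
      Algebra.adjoin_le (Set.singleton_subset_iff.2 (ht k hk))
    exact hle (aeval_mem_adjoin_singleton _ (g k))

theorem aeval_t_injective (hgap : IsGapChoice N gap) {k : ℕ} (hk : k ∈ Set.Icc 1 (N - 1)) :
    Function.Injective (Polynomial.aeval (R := K) (t K N gap k)) := by
  intro p q hpq
  have h1 := congrArg (rep K) hpq
  rw [rep_aeval_t hgap hk, rep_aeval_t hgap hk] at h1
  have h2 := congrFun (Matrix.diagonal_injective h1) (config N (Finset.Icc 1 k))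
  have hk' := hk.2
  have h3 : (config N (Finset.Icc 1 k)).card = k := by
    rw [card_config (Finset.Icc_subset_Icc_right (by omega))]; simp
  rw [eigenvalue, if_pos h3] at h2
  have hs : ((-1) ^ (k - 1) * (-1) ^ (k - 1) : K) = 1 := by simp [← mul_pow]
  rw [← aeval_C_mul_X_comp hs p, h2, aeval_C_mul_X_comp hs]

theorem exists_polynomial_equiv_adjoin_t (hgap : IsGapChoice N gap) {k : ℕ} (hk : k ∈ Set.Icc 1 (N - 1)) :
    ∃ e : K[X] ≃ₐ[K] Algebra.adjoin K {t K N gap k},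
      (e Polynomial.X : AffineNilTL K N) = t K N gap k := by
  refine ⟨(AlgEquiv.ofInjective _ (aeval_t_injective hgap hk)).trans
    (Subalgebra.equivOfEq _ _ (Algebra.adjoin_singleton_eq_range_aeval K _).symm), ?_⟩
  exact Polynomial.aeval_X _

theorem iSup_summand (hgap : IsGapChoice N gap) :
    (⨆ k : Fin N, summand K N gap k) =
      Subalgebra.toSubmodule (Subalgebra.center K (AffineNilTL K N)) := by
  refine le_antisymm (iSup_le fun k x hx => ?_) fun x hx => ?_
  · by_cases hk : (k : ℕ) = 0
    · rw [summand, if_pos hk] at hx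
      exact (Submodule.span_singleton_le_iff_mem _ _).2 (one_mem (Subalgebra.center K _)) hx
    · have hk' : (k : ℕ) ∈ Set.Icc 1 (N - 1) := ⟨by omega, by omega⟩
      obtain ⟨g, rfl⟩ := exists_of_mem_summand hk hx
      exact mul_mem (S := Subalgebra K _) (t_mem_center hgap hk') (aeval_t_mem_center hgap hk' g)
  · obtain ⟨c, g, rfl⟩ := exists_center_decomposition hgap hx
    refine add_mem ?_ (sum_mem fun k hk => ?_)
    · refine Submodule.mem_iSup_of_mem (⟨0, NeZero.pos N⟩ : Fin N) ?_
      rw [summand, if_pos rfl, Algebra.algebraMap_eq_smul_one]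
      exact Submodule.smul_mem _ _ (Submodule.mem_span_singleton_self _)
    · rw [Finset.mem_Icc] at hk
      refine Submodule.mem_iSup_of_mem (⟨k, by omega⟩ : Fin N) ?_
      rw [summand, if_neg (by simp; omega)]
      exact ⟨_, aeval_mem_adjoin_singleton _ (g k), rfl⟩

/-- Divisibility by `X` separates these summands from the scalars, the support separates them from
each other. -/
theorem rep_of_mem_summand (hgap : IsGapChoice N gap) {k : Fin N} (hk : (k : ℕ) ≠ 0) {x : AffineNilTL K N}
    (hx : x ∈ summand K N gap k) :
    ∃ r : K[X], rep K x =
      Matrix.diagonalAlgHom K fun S => if S.card = (k : ℕ) then Polynomial.X * r else 0 := by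
  have hk' : (k : ℕ) ∈ Set.Icc 1 (N - 1) := ⟨by omega, by omega⟩
  obtain ⟨g, rfl⟩ := exists_of_mem_summand hk hx
  refine ⟨Polynomial.C ((-1) ^ ((k : ℕ) - 1)) *
    Polynomial.aeval (Polynomial.C ((-1) ^ ((k : ℕ) - 1)) * Polynomial.X) g, ?_⟩
  rw [map_mul, rep_t hgap hk', rep_aeval_t hgap hk', ← map_mul]
  refine congrArg _ (funext fun S => ?_)
  rw [Pi.mul_apply, eigenvalue]
  split_ifs with h
  · ring
  · rw [zero_mul]

theorem iSupIndep_summand (hgap : IsGapChoice N gap) : iSupIndep (summand K N gap) := by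
  intro i
  by_cases hi : (i : ℕ) = 0
  · let V : Submodule K (AffineNilTL K N) :=
      { carrier := {x | rep K x ∅ ∅ = 0}
        add_mem' := fun {x y} (hx : _ = _) (hy : _ = _) => by
          simp only [Set.mem_ofPred_eq, map_add, Matrix.add_apply, hx, hy, add_zero]
        zero_mem' := by simp
        smul_mem' := fun c x (hx : _ = _) => by
          simp only [Set.mem_ofPred_eq, map_smul, Matrix.smul_apply, hx, smul_zero] }
    have hV : (⨆ j ≠ i, summand K N gap j) ≤ V := by
      refine iSup₂_le fun j hj x hx => ?_
      have hj' : (j : ℕ) ≠ 0 := fun h => hj (Fin.ext (h.trans hi.symm))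
      obtain ⟨r, hr⟩ := rep_of_mem_summand hgap hj' hx
      change rep K x ∅ ∅ = 0
      rw [hr, Matrix.diagonalAlgHom_apply, Matrix.diagonal_apply_eq, if_neg (by simp [Ne.symm hj'])]
    refine Disjoint.mono_right hV (Submodule.disjoint_def.2 fun x hx hxV => ?_)
    rw [summand, if_pos hi] at hx
    obtain ⟨c, rfl⟩ := Submodule.mem_span_singleton.1 hx
    have h1 : rep K (c • 1) ∅ ∅ = 0 := hxV
    rw [map_smul, map_one, Matrix.smul_apply, Matrix.one_apply_eq, smul_eq_zero] at h1
    rw [h1.resolve_right one_ne_zero, zero_smul]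
  -- Elements constant on `i`-particle configurations include the scalars and all other summands,
  -- whereas a constant of the form `X * r` is zero.
  · let V : Submodule K (AffineNilTL K N) :=
      { carrier := {x | ∀ n S, n ≠ 0 → S.card = (i : ℕ) → (rep K x S S).coeff n = 0}
        add_mem' := fun {x y} hx hy n S hn hS => by
          rw [map_add, Matrix.add_apply, Polynomial.coeff_add, hx n S hn hS, hy n S hn hS, add_zero]
        zero_mem' := by simp
        smul_mem' := fun c x hx n S hn hS => by
          rw [map_smul, Matrix.smul_apply, Polynomial.coeff_smul, hx n S hn hS, smul_zero] }
    have hV : (⨆ j ≠ i, summand K N gap j) ≤ V := by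
      refine iSup₂_le fun j hj x hx n S hn hS => ?_
      by_cases hj' : (j : ℕ) = 0
      · rw [summand, if_pos hj'] at hx
        obtain ⟨c, rfl⟩ := Submodule.mem_span_singleton.1 hx
        rw [map_smul, map_one, Matrix.smul_apply, Matrix.one_apply_eq, Polynomial.coeff_smul,
          Polynomial.coeff_one, if_neg hn, smul_zero]
      · obtain ⟨r, hr⟩ := rep_of_mem_summand hgap hj' hx
        rw [hr, Matrix.diagonalAlgHom_apply, Matrix.diagonal_apply_eq,
          if_neg (fun h => hj (Fin.ext (h.symm.trans hS))), Polynomial.coeff_zero]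
    refine Disjoint.mono_right hV (Submodule.disjoint_def.2 fun x hx hxV => ?_)
    obtain ⟨r, hr⟩ := rep_of_mem_summand hgap hi hx
    apply rep_injective K
    rw [hr, map_zero]
    refine (congrArg _ (funext fun S => ?_)).trans (map_zero _)
    split_ifs with hS
    · ext n
      rcases Nat.eq_zero_or_pos n with rfl | hn
      · simp
      · have := hxV n S hn.ne' hS
        rwa [hr, Matrix.diagonalAlgHom_apply, Matrix.diagonal_apply_eq, if_pos hS] at this
    · rfl

theorem exists_presentation_equiv_center (hgap : IsGapChoice N gap) :
    ∃ e : (MvPolynomial (Set.Icc 1 (N - 1)) K ⧸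
          Ideal.span {p : MvPolynomial (Set.Icc 1 (N - 1)) K |
            ∃ k l : Set.Icc 1 (N - 1), k ≠ l ∧ p = MvPolynomial.X k * MvPolynomial.X l})
        ≃ₐ[K] Subalgebra.center K (AffineNilTL K N),
      ∀ k : Set.Icc 1 (N - 1),
        (e (Ideal.Quotient.mk _ (MvPolynomial.X k)) : AffineNilTL K N) = t K N gap (k : ℕ) := by
  classical
  let τ : Set.Icc 1 (N - 1) → Subalgebra.center K (AffineNilTL K N) := fun k =>
    ⟨t K N gap k, t_mem_center hgap k.2⟩
  let f := MvPolynomial.aeval (R := K) τ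
  have hsurj : Function.Surjective f := by
    rw [← AlgHom.range_eq_top, ← Algebra.adjoin_range_eq_range_aeval]
    apply Subalgebra.map_injective (f := (Subalgebra.center K (AffineNilTL K N)).val)
      Subtype.val_injective
    rw [AlgHom.map_adjoin, Algebra.map_top, Subalgebra.range_val]
    refine Eq.trans ?_ (adjoin_t_eq_center hgap)
    congr 1
    rw [← Set.range_comp, Set.image_eq_range]
    rfl
  have hker : Ideal.span {p : MvPolynomial (Set.Icc 1 (N - 1)) K |
      ∃ k l : Set.Icc 1 (N - 1), k ≠ l ∧ p = MvPolynomial.X k * MvPolynomial.X l} =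
      RingHom.ker f := by
    refine le_antisymm (Ideal.span_le.2 ?_) fun P hP => ?_
    · rintro _ ⟨k, l, hkl, rfl⟩
      rw [SetLike.mem_coe, RingHom.mem_ker, map_mul, MvPolynomial.aeval_X, MvPolynomial.aeval_X]
      exact Subtype.ext (t_mul_t hgap k.2 l.2 (fun h => hkl (Subtype.ext h)))
    -- The entry of `f P` at `k` particles is `P` with `T_k = ±X` and the other variables `0`, so no
    -- power of a single variable, nor a constant, survives in `P`.
    · have hcoeff : ∀ (k : Set.Icc 1 (N - 1)) n, P.coeff (Finsupp.single k n) = 0 := by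
        intro k n
        have h1 : MvPolynomial.aeval (fun k : Set.Icc 1 (N - 1) => eigenvalue K N k) P = 0 := by
          apply Matrix.diagonal_injective
          have h2 : rep K (f P : AffineNilTL K N) = 0 := by
            rw [show f P = 0 from hP]; simp
          have h3 : rep K (f P : AffineNilTL K N) = Matrix.diagonalAlgHom K
              (MvPolynomial.aeval (fun k : Set.Icc 1 (N - 1) => eigenvalue K N k) P) := by
            have h4 : ((rep K).comp (Subalgebra.center K (AffineNilTL K N)).val).comp f =
                (Matrix.diagonalAlgHom K).comp
                  (MvPolynomial.aeval fun k : Set.Icc 1 (N - 1) => eigenvalue K N k) := by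
              refine MvPolynomial.algHom_ext fun k => ?_
              simp only [AlgHom.comp_apply, f, MvPolynomial.aeval_X]
              exact rep_t hgap k.2
            exact DFunLike.congr_fun h4 P
          rw [h2] at h3
          rw [Matrix.diagonal_zero']
          exact h3.symm
        have h5 := congrArg (Pi.evalAlgHom K (fun _ => K[X]) (config N (Finset.Icc 1 (k : ℕ)))) h1
        rw [← AlgHom.comp_apply, MvPolynomial.comp_aeval, map_zero] at h5
        have hk := k.2.2
        have h6 : (config N (Finset.Icc 1 (k : ℕ))).card = k := by
          rw [card_config (Finset.Icc_subset_Icc_right (by omega))]; simp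
        have h7 := coeff_aeval_ite k ((-1 : K) ^ ((k : ℕ) - 1)) P n
        have h8 : (fun l : Set.Icc 1 (N - 1) => (Pi.evalAlgHom K (fun _ => K[X])
            (config N (Finset.Icc 1 (k : ℕ)))) (eigenvalue K N l)) = fun l => if l = k then
              Polynomial.C ((-1 : K) ^ ((k : ℕ) - 1)) * Polynomial.X else 0 := by
          funext l
          rw [Pi.evalAlgHom_apply, eigenvalue, h6]
          by_cases hlk : l = k
          · simp [hlk]
          · rw [if_neg hlk, if_neg fun h => hlk (Subtype.ext h.symm)]
        rw [← h8, h5, Polynomial.coeff_zero] at h7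
        refine (mul_eq_zero.1 h7.symm).resolve_left (pow_ne_zero _ (pow_ne_zero _ ?_))
        exact neg_ne_zero.2 one_ne_zero
      have hset : {p : MvPolynomial (Set.Icc 1 (N - 1)) K |
          ∃ k l : Set.Icc 1 (N - 1), k ≠ l ∧ p = MvPolynomial.X k * MvPolynomial.X l} =
          (fun m => MvPolynomial.monomial m 1) '' {m | ∃ k l : Set.Icc 1 (N - 1), k ≠ l ∧
            m = Finsupp.single k 1 + Finsupp.single l 1} := by
        ext p
        constructor
        · rintro ⟨k, l, hkl, rfl⟩
          exact ⟨_, ⟨k, l, hkl, rfl⟩, by simp [MvPolynomial.X, MvPolynomial.monomial_mul]⟩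
        · rintro ⟨_, ⟨k, l, hkl, rfl⟩, rfl⟩
          exact ⟨k, l, hkl, by simp [MvPolynomial.X, MvPolynomial.monomial_mul]⟩
      rw [hset, MvPolynomial.mem_ideal_span_monomial_image]
      intro m hm
      by_contra! hno
      have h3 : 3 ≤ N := Fact.out
      -- A monomial divisible by no `T_k T_l` involves at most one variable; for the trivial
      -- monomial any index serves.
      obtain ⟨k, hk⟩ : ∃ k : Set.Icc 1 (N - 1), ∀ l, l ≠ k → m l = 0 := by
        by_cases h0 : ∃ k, m k ≠ 0
        · obtain ⟨k, hk⟩ := h0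
          refine ⟨k, fun l hlk => by_contra fun hl => ?_⟩
          refine hno _ ⟨k, l, hlk.symm, rfl⟩ fun j => ?_
          simp only [Finsupp.add_apply, Finsupp.single_apply]
          split_ifs with h1 h2 h2
          · exact absurd (h2.trans h1.symm) hlk
          · subst h1; omega
          · subst h2; omega
          · omega
        · push Not at h0
          exact ⟨⟨1, by simp; omega⟩, fun l _ => h0 l⟩
      have hmk : m = Finsupp.single k (m k) := by
        ext l
        by_cases hl : l = k
        · subst hl; simp
        · simp [hk l hl, Ne.symm hl]
      rw [MvPolynomial.mem_support_iff, hmk] at hm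
      exact hm (hcoeff k _)
  refine ⟨(Ideal.quotientEquivAlgOfEq K hker).trans
    (Ideal.quotientKerAlgEquivOfSurjective hsurj), fun k => ?_⟩
  have : f (MvPolynomial.X k) = τ k := MvPolynomial.aeval_X _ _
  exact congrArg Subtype.val this

end Decomposition

end AffineNilTL

theorem theorem5p5 (K : Type*) [Field K] (N : ℕ) (hN : 3 ≤ N)
    (gap : Finset ℕ → ℕ)
    (hgap : ∀ I : Finset ℕ, I ⊆ Finset.Icc 1 N → 1 ≤ I.card → I.card ≤ N - 1 →
      AffineNilTL.IsGap N I (gap I)) :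
    -- the center is generated by `1` and the `t_k`, which are central
    (∀ k ∈ Set.Icc 1 (N - 1),
      AffineNilTL.t K N gap k ∈ Subalgebra.center K (AffineNilTL K N)) ∧
    Algebra.adjoin K (AffineNilTL.t K N gap '' Set.Icc 1 (N - 1)) =
      Subalgebra.center K (AffineNilTL K N) ∧
    -- each `t_k` generates a polynomial ring
    (∀ k ∈ Set.Icc 1 (N - 1),
      ∃ e : K[X] ≃ₐ[K] Algebra.adjoin K {AffineNilTL.t K N gap k},
        (e Polynomial.X : AffineNilTL K N) = AffineNilTL.t K N gap k) ∧
    (∀ k ∈ Set.Icc 1 (N - 1), ∀ l ∈ Set.Icc 1 (N - 1), k ≠ l →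
      AffineNilTL.t K N gap k * AffineNilTL.t K N gap l = 0) ∧
    -- the center is the direct sum of `K` and the `t_k K[t_k]`
    iSupIndep (AffineNilTL.summand K N gap) ∧
    (⨆ k : Fin N, AffineNilTL.summand K N gap k) =
      Subalgebra.toSubmodule (Subalgebra.center K (AffineNilTL K N)) ∧
    -- presentation of the center
    ∃ e : (MvPolynomial (Set.Icc 1 (N - 1)) K ⧸
          Ideal.span {p : MvPolynomial (Set.Icc 1 (N - 1)) K |
            ∃ k l : Set.Icc 1 (N - 1), k ≠ l ∧ p = MvPolynomial.X k * MvPolynomial.X l})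
        ≃ₐ[K] Subalgebra.center K (AffineNilTL K N),
      ∀ k : Set.Icc 1 (N - 1),
        (e (Ideal.Quotient.mk _ (MvPolynomial.X k)) : AffineNilTL K N) =
          AffineNilTL.t K N gap (k : ℕ) := by
  have : Fact (3 ≤ N) := ⟨hN⟩
  have : NeZero N := ⟨by omega⟩
  exact ⟨fun _ => AffineNilTL.t_mem_center hgap, AffineNilTL.adjoin_t_eq_center hgap,
    fun _ => AffineNilTL.exists_polynomial_equiv_adjoin_t hgap,
    fun _ hk _ => AffineNilTL.t_mul_t hgap hk,
    AffineNilTL.iSupIndep_summand hgap, AffineNilTL.iSup_summand hgap,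
    AffineNilTL.exists_presentation_equiv_center hgap⟩
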